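/- Let $g>0$, $\mu>0$, and let $\bar\rho\in C^\infty(\mathbb R)\cap L^\infty(\mathbb R)$ satisfy $\bar\rho'\in C_0^\infty(\mathbb R)$, $\inf_{\mathbb R}\bar\rho>0$ and $\bar\rho'(x^0)>0$ for some $x^0\in\mathbb R$. All functions are real-valued. Put $$M_{\mathrm c}:=\Big(\sup_{0\not\equiv\psi\in H^1(\mathbb R)}\frac{\int_{\mathbb R} g\bar\rho'|\psi|^2\,dx}{\int_{\mathbb R}|\psi'|^2\,dx}\Big)^{1/2}\in(0,\infty].$$ Let the constant magnetic field be either $\bar{\mathbf M}=M\mathbf e_1$ with $M\neq0$ (horizontal case) or $\bar{\mathbf M}=M\mathbf e_3$ with $0<|M|<M_{\mathrm c}$ (vertical case). For $\xi=(\xi_1,\xi_2)\in\mathbb R^2$ with $0<|M\xi_1|/|\xi|<M_{\mathrm c}$ put $$S(\xi):=\Big(\sup_{0\not\equiv\psi\in H^1(\mathbb R)}\frac{\frac{g|\xi|^2}{(M\xi_1)^2}\int_{\mathbb R}\bar\rho'\psi^2\,dx-\int_{\mathbb R}|\psi'|^2\,dx}{\int_{\mathbb R}|\psi|^2\,dx}\Big)^{1/2},$$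 and, in the vertical case, $$|\xi|_{\mathrm{vc}}^M:=\Big(\inf\Big\{\frac{M^2\int_{\mathbb R}|\psi''|^2\,dx}{\int_{\mathbb R}(g\bar\rho'\psi^2-M^2|\psi'|^2)\,dx}\;:\;\psi\in H^2(\mathbb R),\ \int_{\mathbb R}(g\bar\rho'\psi^2-M^2|\psi'|^2)\,dx>0\Big\}\Big)^{1/2}.$$ The solvable domain is $$\mathbb A^{\mathrm g}:=\begin{cases}\big(\{\xi\in\mathbb R^2: 0<|M\xi_1|/|\xi|<M_{\mathrm c},\ |\xi|<S(\xi)\}\cup\{\xi:\xi_1=0\}\big)\setminus\{\mathbf 0\}&\text{if }\bar{\mathbf M}=M\mathbf e_1,\\ \{\xi\in\mathbb R^2:|\xi|>|\xi|^M_{\mathrm{vc}}\}&\text{if }\bar{\mathbf M}=M\mathbf e_3.\end{cases}$$ Then for each $\xi\in\mathbb A^{\mathrm g}$ there exist $\lambda=\lambda(\xi)>0$ and a function $\psi=\psi(\xi,\cdot)\not\equiv0$ in $H^\infty(\mathbb R)=\bigcap_{k\ge0}H^k(\mathbb R)$ (hence smooth) that satisfy, on $\mathbb R$, $$-\lambda^2\big[\bar\rho|\xi|^2\psi-(\bar\rho\psi')'\big]=\lambda\mu\big(|\xi|^4\psi-2|\xi|^2\psi''+\psi''''\big)-g|\xi|^2\bar\rho'\psi+M^2\begin{cases}\xi_1^2(|\xi|^2\psi-\psi'')&\text{if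 }\bar{\mathbf M}=M\mathbf e_1,\\ \psi''''-|\xi|^2\psi''&\text{if }\bar{\mathbf M}=M\mathbf e_3,\end{cases}$$ together with $\psi(\pm\infty)=\psi'(\pm\infty)=0$ and the normalization $\int_{\mathbb R}\bar\rho\,(|\xi|^2|\psi|^2+|\psi'|^2)\,dx=1$. -/

import Mathlib

open MeasureTheory Filter Topology
open scoped ContDiff ENNReal

noncomputable section

/-- `f'` is the weak derivative of `f` on the real line, tested against `C_0^∞(ℝ)`. -/
def HasWeakDeriv (f f' : ℝ → ℝ) : Prop :=
  LocallyIntegrable f ∧ LocallyIntegrable f' ∧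
    ∀ φ : ℝ → ℝ, ContDiff ℝ ∞ φ → HasCompactSupport φ →
      ∫ x, f x * deriv φ x = -∫ x, f' x * φ x

/-- Membership in the Sobolev space `H^k(ℝ) = W^{k,2}(ℝ)` of real-valued functions. -/
def MemH : ℕ → (ℝ → ℝ) → Prop
  | 0, f => MemLp f 2
  | k + 1, f => MemLp f 2 ∧ ∃ f' : ℝ → ℝ, HasWeakDeriv f f' ∧ MemH k f'

/-- Membership in `H^∞(ℝ) = ⋂ₖ H^k(ℝ)`. -/
def MemHInfty (f : ℝ → ℝ) : Prop := ∀ k : ℕ, MemH k f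

/-- Smooth Rayleigh–Taylor density profiles: bounded, with compactly supported derivative, bounded
below by a positive constant, and increasing near some height. -/
structure IsRTProfile (ρ : ℝ → ℝ) : Prop where
  smooth : ContDiff ℝ ∞ ρ
  bounded : MemLp ρ ⊤
  compactSupport_deriv : HasCompactSupport (deriv ρ)
  inf_pos : ∃ c : ℝ, 0 < c ∧ ∀ x, c ≤ ρ x
  exists_deriv_pos : ∃ x, 0 < deriv ρ x

/-- The direction of the constant magnetic field: `M e₁` (horizontal) or `M e₃` (vertical). -/
inductive FieldDirection
  | horizontal
  | vertical

/-- The set of the quotients `∫ g ρ' |ψ|² / ∫ |ψ'|²` over `0 ≢ ψ ∈ H¹(ℝ)`. -/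
def criticalQuotients (g : ℝ) (ρ : ℝ → ℝ) : Set EReal :=
  {r | ∃ ψ ψ' : ℝ → ℝ, MemH 1 ψ ∧ HasWeakDeriv ψ ψ' ∧ ¬ ψ =ᵐ[volume] 0 ∧
    r = (((∫ x, g * deriv ρ x * ψ x ^ 2) / (∫ x, ψ' x ^ 2) : ℝ) : EReal)}

/-- The critical number `M_c ∈ [0, ∞]`, the square root of the supremum of the quotients (which is
positive for a Rayleigh–Taylor profile and may be infinite). -/
def criticalNumber (g : ℝ) (ρ : ℝ → ℝ) : ℝ≥0∞ :=
  (sSup (criticalQuotients g ρ)).toENNReal ^ (1 / 2 : ℝ)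

/-- The critical frequency function `S(ξ)` of the horizontal case. It is only used for `M ξ₁ ≠ 0`,
where the quotients are bounded above by `g |ξ|² sup |ρ'| / (M ξ₁)²`. -/
def criticalFrequency (g M : ℝ) (ρ : ℝ → ℝ) (ξ : EuclideanSpace ℝ (Fin 2)) : ℝ :=
  √(sSup {r : ℝ | ∃ ψ ψ' : ℝ → ℝ, MemH 1 ψ ∧ HasWeakDeriv ψ ψ' ∧ ¬ ψ =ᵐ[volume] 0 ∧
    r = (g * ‖ξ‖ ^ 2 * (∫ x, deriv ρ x * ψ x ^ 2) / (M * ξ 0) ^ 2 - ∫ x, ψ' x ^ 2) /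
      ∫ x, ψ x ^ 2})

/-- The critical frequency constant `|ξ|_vc^M` of the vertical case; it is only used for
`0 < |M| < M_c`, where the set of quotients is nonempty. -/
def verticalCriticalFrequency (g M : ℝ) (ρ : ℝ → ℝ) : ℝ :=
  √(sInf {r : ℝ | ∃ ψ ψ' ψ'' : ℝ → ℝ, MemH 2 ψ ∧ HasWeakDeriv ψ ψ' ∧ HasWeakDeriv ψ' ψ'' ∧
    0 < (∫ x, (g * deriv ρ x * ψ x ^ 2 - M ^ 2 * ψ' x ^ 2)) ∧
    r = (M ^ 2 * ∫ x, ψ'' x ^ 2) / ∫ x, (g * deriv ρ x * ψ x ^ 2 - M ^ 2 * ψ' x ^ 2)})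

/-- The solvable domain `𝔸^g` of horizontal frequencies. -/
def solvableDomain (g M : ℝ) (ρ : ℝ → ℝ) : FieldDirection → Set (EuclideanSpace ℝ (Fin 2))
  | .horizontal =>
      ({ξ | 0 < |ξ 0 * M| / ‖ξ‖ ∧ ENNReal.ofReal (|ξ 0 * M| / ‖ξ‖) < criticalNumber g ρ ∧
          ‖ξ‖ < criticalFrequency g M ρ ξ} ∪ {ξ | ξ 0 = 0}) \ {0}
  | .vertical => {ξ | verticalCriticalFrequency g M ρ < ‖ξ‖}

/-- The magnetic term of the ordinary differential equation, without the factor `M²`. -/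
def magneticTerm (ξ : EuclideanSpace ℝ (Fin 2)) (ψ : ℝ → ℝ) (x : ℝ) : FieldDirection → ℝ
  | .horizontal => ξ 0 ^ 2 * (‖ξ‖ ^ 2 * ψ x - iteratedDeriv 2 ψ x)
  | .vertical => iteratedDeriv 4 ψ x - ‖ξ‖ ^ 2 * iteratedDeriv 2 ψ x

/-- The fourth-order equation with eigenvalue parameter `lam`, in the classical sense on `ℝ`. -/
def SatisfiesODE (d : FieldDirection) (μ g M : ℝ) (ρ : ℝ → ℝ) (ξ : EuclideanSpace ℝ (Fin 2))
    (lam : ℝ) (ψ : ℝ → ℝ) : Prop :=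
  ∀ x : ℝ,
    -lam ^ 2 * (ρ x * ‖ξ‖ ^ 2 * ψ x - deriv (fun y => ρ y * deriv ψ y) x) =
      lam * μ * (‖ξ‖ ^ 4 * ψ x - 2 * ‖ξ‖ ^ 2 * iteratedDeriv 2 ψ x + iteratedDeriv 4 ψ x)
        - g * ‖ξ‖ ^ 2 * deriv ρ x * ψ x + M ^ 2 * magneticTerm ξ ψ x d

/-- `ψ` and its derivative vanish at `±∞`. -/
def VanishesAtInfinity (ψ : ℝ → ℝ) : Prop :=
  Tendsto ψ atBot (𝓝 0) ∧ Tendsto (deriv ψ) atBot (𝓝 0) ∧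
    Tendsto ψ atTop (𝓝 0) ∧ Tendsto (deriv ψ) atTop (𝓝 0)

/-- The admissible set `𝒜` of those `ψ ∈ H²(ℝ)` with `∫ ρ (|ξ|² |ψ|² + |ψ'|²) = 1`. -/
def admissibleSet (ρ : ℝ → ℝ) (ξ : EuclideanSpace ℝ (Fin 2)) : Set (ℝ → ℝ) :=
  {ψ | MemH 2 ψ ∧ ∃ ψ' : ℝ → ℝ, HasWeakDeriv ψ ψ' ∧
    ∫ x, ρ x * (‖ξ‖ ^ 2 * ψ x ^ 2 + ψ' x ^ 2) = 1}

end

/-!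
The equation with eigenvalue parameter `lam` is the Euler–Lagrange equation of a quadratic form
on `H²(ℝ)` that depends continuously on `lam`. At `lam = 0` the form is negative somewhere, exactly
because the frequency is solvable; for large `lam` viscosity makes it nonnegative. At the least
`lam` for which it is nonnegative there are unit vectors along which it tends to zero. The form
differs from a coercive one only by `∫ g k² ρ' u²`, which is weakly continuous since `ρ'` has
compact support, so a weak limit of these vectors is a nonzero minimizer, and by the Cauchy–Schwarz
inequality it lies in the kernel of the form. Being a weak solution of a fourth-order equation with
constant leading coefficient, it is smooth, and bootstrapping the equation in `L²` puts it in
`H^∞(ℝ)`.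
-/

/-! ### Weak derivatives -/

/-- The test functions `C_0^∞(ℝ)` of the definition of weak derivatives. -/
structure IsTestFunction (φ : ℝ → ℝ) : Prop where
  contDiff : ContDiff ℝ ∞ φ
  hasCompactSupport : HasCompactSupport φ

namespace IsTestFunction

variable {φ ψ : ℝ → ℝ}

theorem continuous (hφ : IsTestFunction φ) : Continuous φ := hφ.contDiff.continuous

theorem hasDerivAt (hφ : IsTestFunction φ) (x : ℝ) : HasDerivAt φ (deriv φ x) x :=
  (hφ.contDiff.differentiable (by simp) x).hasDerivAt

theorem deriv (hφ : IsTestFunction φ) : IsTestFunction (deriv φ) :=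
  ⟨(contDiff_infty_iff_deriv.1 hφ.contDiff).2, hφ.hasCompactSupport.deriv⟩

theorem memLp (hφ : IsTestFunction φ) (p : ℝ≥0∞) : MemLp φ p :=
  hφ.continuous.memLp_of_hasCompactSupport hφ.hasCompactSupport

theorem integrable (hφ : IsTestFunction φ) : Integrable φ :=
  memLp_one_iff_integrable.1 (hφ.memLp 1)

theorem integrable_mul (hφ : IsTestFunction φ) {f : ℝ → ℝ} (hf : LocallyIntegrable f) :
    Integrable fun x => f x * φ x :=
  hf.integrable_smul_right_of_hasCompactSupport hφ.continuous hφ.hasCompactSupport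

theorem sub (hφ : IsTestFunction φ) (hψ : IsTestFunction ψ) :
    IsTestFunction fun x => φ x - ψ x :=
  ⟨hφ.contDiff.sub hψ.contDiff, hφ.hasCompactSupport.sub hψ.hasCompactSupport⟩

theorem const_mul (hφ : IsTestFunction φ) (a : ℝ) : IsTestFunction fun x => a * φ x :=
  ⟨contDiff_const.mul hφ.contDiff, hφ.hasCompactSupport.mul_left⟩

theorem exists_deriv_eq (hφ : IsTestFunction φ) (h0 : ∫ x, φ x = 0) :
    ∃ Φ, IsTestFunction Φ ∧ _root_.deriv Φ = φ := by
  set Φ : ℝ → ℝ := fun x => ∫ t in Set.Iic x, φ t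
  have hi := hφ.integrable
  have hΦ (x : ℝ) : HasDerivAt Φ (φ x) x := by
    have hsplit : Φ = fun x => Φ 0 + ∫ t in (0 : ℝ)..x, φ t := by
      funext x
      rw [← intervalIntegral.integral_Iic_sub_Iic hi.integrableOn hi.integrableOn]
      exact (add_sub_cancel _ _).symm
    rw [hsplit]
    exact (hφ.continuous.integral_hasStrictDerivAt 0 x).hasDerivAt.const_add _
  have hderiv : _root_.deriv Φ = φ := funext fun x => (hΦ x).deriv
  obtain ⟨R, -, hR⟩ := hφ.hasCompactSupport.exists_pos_le_norm
  have hsupp : HasCompactSupport Φ := by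
    refine HasCompactSupport.intro (isCompact_Icc (a := -R) (b := R)) fun x hx => ?_
    rcases lt_or_ge x (-R) with hlt | hge
    · exact setIntegral_eq_zero_of_forall_eq_zero fun t ht => hR t <|
        (le_neg.1 (ht.out.trans hlt.le)).trans (neg_le_abs t)
    · have hxR : R < x := not_le.1 fun h => hx ⟨hge, h⟩
      rw [← h0]
      exact setIntegral_eq_integral_of_forall_compl_eq_zero fun t ht => hR t <|
        (hxR.trans (not_le.1 ht)).le.trans (le_abs_self t)
  exact ⟨Φ, ⟨contDiff_infty_iff_deriv.2 ⟨fun x => (hΦ x).differentiableAt, hderiv ▸ hφ.contDiff⟩,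
    hsupp⟩, hderiv⟩

theorem exists_integral_eq_one : ∃ θ, IsTestFunction θ ∧ ∫ x, θ x = 1 :=
  let θ : ContDiffBump (0 : ℝ) := default
  ⟨θ.normed volume, ⟨θ.contDiff_normed, θ.hasCompactSupport_normed⟩, θ.integral_normed⟩

end IsTestFunction

/-- A du Bois-Reymond lemma. -/
theorem exists_forall_integral_mul_deriv_add_eq {v w : ℝ → ℝ} (hv : LocallyIntegrable v)
    (hw : LocallyIntegrable w) (h : ∀ φ, IsTestFunction φ →
      (∫ x, v x * deriv (deriv φ) x) + ∫ x, w x * deriv φ x = 0) :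
    ∃ κ, ∀ φ, IsTestFunction φ → (∫ x, v x * deriv φ x) + ∫ x, w x * φ x = κ * ∫ x, φ x := by
  obtain ⟨θ, hθ, hθ1⟩ := IsTestFunction.exists_integral_eq_one
  refine ⟨(∫ x, v x * deriv θ x) + ∫ x, w x * θ x, fun φ hφ => ?_⟩
  set s := ∫ x, φ x
  have hmean : ∫ x, (φ x - s * θ x) = 0 := by
    rw [integral_sub hφ.integrable (hθ.integrable.const_mul s), integral_const_mul, hθ1, mul_one,
      sub_self]
  obtain ⟨Φ, hΦ, hΦφ⟩ := (hφ.sub (hθ.const_mul s)).exists_deriv_eq hmean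
  have hderiv : deriv (deriv Φ) = fun x => deriv φ x - s * deriv θ x := by
    rw [hΦφ]
    exact funext fun x => ((hφ.hasDerivAt x).fun_sub ((hθ.hasDerivAt x).const_mul s)).deriv
  have hlin {f η ζ : ℝ → ℝ} (hf : LocallyIntegrable f) (hη : IsTestFunction η)
      (hζ : IsTestFunction ζ) : ∫ x, f x * (η x - s * ζ x) =
        (∫ x, f x * η x) - s * ∫ x, f x * ζ x := by
    rw [← integral_const_mul, ← integral_sub (hη.integrable_mul hf)
      ((hζ.integrable_mul hf).const_mul s)]
    exact integral_congr_ae (ae_of_all _ fun x => by ring)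
  have := h Φ hΦ
  rw [hderiv, hΦφ, hlin hv hφ.deriv hθ.deriv, hlin hw hφ hθ] at this
  linarith

namespace HasWeakDeriv

variable {f f' g g' : ℝ → ℝ}

theorem integral_mul_deriv (h : HasWeakDeriv f f') {φ : ℝ → ℝ} (hφ : IsTestFunction φ) :
    ∫ x, f x * deriv φ x = -∫ x, f' x * φ x :=
  h.2.2 φ hφ.contDiff hφ.hasCompactSupport

theorem congr (h : HasWeakDeriv f f') (hf : f =ᵐ[volume] g) (hf' : f' =ᵐ[volume] g') :
    HasWeakDeriv g g' := by
  refine ⟨h.1.congr hf, h.2.1.congr hf', fun φ hφ hs => ?_⟩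
  have hl : ∫ x, f x * deriv φ x = ∫ x, g x * deriv φ x :=
    integral_congr_ae (hf.mono fun x hx => by simp only [hx])
  have hr : ∫ x, f' x * φ x = ∫ x, g' x * φ x :=
    integral_congr_ae (hf'.mono fun x hx => by simp only [hx])
  rw [← hl, ← hr, h.2.2 φ hφ hs]

theorem of_hasDerivAt (hd : ∀ x, HasDerivAt f (f' x) x) (hc : Continuous f') :
    HasWeakDeriv f f' := by
  have hcf : Continuous f := continuous_iff_continuousAt.2 fun x => (hd x).continuousAt
  refine ⟨hcf.locallyIntegrable, hc.locallyIntegrable, fun φ hφ hs => ?_⟩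
  have hφ : IsTestFunction φ := ⟨hφ, hs⟩
  exact integral_mul_deriv_eq_deriv_mul_of_integrable (fun x _ => hd x)
    (fun x _ => hφ.hasDerivAt x) (hφ.deriv.integrable_mul hcf.locallyIntegrable)
    (hφ.integrable_mul hc.locallyIntegrable) (hφ.integrable_mul hcf.locallyIntegrable)

end HasWeakDeriv

theorem ae_eq_of_forall_integral_mul_eq {f g : ℝ → ℝ} (hf : LocallyIntegrable f)
    (hg : LocallyIntegrable g)
    (h : ∀ φ, IsTestFunction φ → ∫ x, f x * φ x = ∫ x, g x * φ x) : f =ᵐ[volume] g :=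
  ae_eq_of_integral_contDiff_smul_eq hf hg fun φ hφ hs => by
    simpa only [smul_eq_mul, mul_comm] using h φ ⟨hφ, hs⟩

namespace HasWeakDeriv

variable {f f' g g' : ℝ → ℝ}

theorem unique (hf : HasWeakDeriv f f') (hg : HasWeakDeriv f g') : f' =ᵐ[volume] g' :=
  ae_eq_of_forall_integral_mul_eq hf.2.1 hg.2.1 fun _ hφ =>
    neg_injective ((hf.integral_mul_deriv hφ).symm.trans (hg.integral_mul_deriv hφ))

theorem exists_ae_eq_add_const (hf : HasWeakDeriv f f') (hg : HasWeakDeriv g f') :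
    ∃ κ, f =ᵐ[volume] fun x => g x + κ := by
  obtain ⟨κ, hκ⟩ := exists_forall_integral_mul_deriv_add_eq (v := 0) locallyIntegrable_zero
    (hf.1.sub hg.1) fun φ hφ => by
      simp only [Pi.zero_apply, zero_mul, integral_zero, zero_add, Pi.sub_apply, sub_mul]
      rw [integral_sub (hφ.deriv.integrable_mul hf.1) (hφ.deriv.integrable_mul hg.1),
        hf.integral_mul_deriv hφ, hg.integral_mul_deriv hφ, sub_self]
  have hκ_loc : LocallyIntegrable fun _ : ℝ => κ := locallyIntegrable_const κ
  refine ⟨κ, ae_eq_of_forall_integral_mul_eq hf.1 (hg.1.add hκ_loc) fun φ hφ => ?_⟩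
  have h := hκ φ hφ
  simp only [Pi.zero_apply, zero_mul, integral_zero, zero_add, Pi.sub_apply, sub_mul] at h
  rw [integral_sub (hφ.integrable_mul hf.1) (hφ.integrable_mul hg.1)] at h
  simp only [add_mul]
  rw [integral_add (hφ.integrable_mul hg.1) (hφ.integrable.const_mul κ), integral_const_mul]
  linarith

theorem integral_primitive {r : ℝ → ℝ} (hr : LocallyIntegrable r) :
    HasWeakDeriv (fun x => ∫ t in (0 : ℝ)..x, r t) r := by
  set F : ℝ → ℝ := fun x => ∫ t in (0 : ℝ)..x, r t
  have hri (a b : ℝ) : IntervalIntegrable r volume a b :=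
    (hr.integrableOn_isCompact isCompact_uIcc).intervalIntegrable
  have hF : Continuous F := intervalIntegral.continuous_primitive hri 0
  refine ⟨hF.locallyIntegrable, hr, fun φ hφ hs => ?_⟩
  obtain ⟨R, hR0, hR⟩ := hs.exists_pos_le_norm
  have hsupp : tsupport φ ⊆ Set.Ioc (-R - 1) (R + 1) := by
    refine (closure_minimal (t := Set.Icc (-R) R) (fun x hx => ?_) isClosed_Icc).trans fun x hx =>
      ⟨by linarith [hx.1], by linarith [hx.2]⟩
    exact abs_le.1 (not_lt.1 fun h => hx (hR x h.le))
  have hend {x : ℝ} (hx : R ≤ |x|) : φ x = 0 := hR x hx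
  have hFac : AbsolutelyContinuousOnInterval F (-R - 1) (R + 1) :=
    (hri _ _).absolutelyContinuousOnInterval_intervalIntegral
      (Set.mem_uIcc_of_le (by linarith) (by linarith))
  have hφac : AbsolutelyContinuousOnInterval φ (-R - 1) (R + 1) :=
    (hφ.of_le (by simp)).contDiffOn.absolutelyContinuousOnInterval
  have hparts := hFac.integral_mul_deriv_eq_deriv_mul hφac
  rw [hend (by rw [abs_of_pos] <;> linarith), hend (by rw [abs_of_neg] <;> linarith), mul_zero,
    mul_zero, sub_zero, zero_sub] at hparts
  have hder : ∫ x in (-R - 1)..(R + 1), deriv F x * φ x = ∫ x in (-R - 1)..(R + 1), r x * φ x :=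
    intervalIntegral.integral_congr_ae
      ((_root_.LocallyIntegrable.ae_hasDerivAt_integral hr).mono fun x hx _ => by
        rw [(hx 0).deriv])
  rwa [hder, intervalIntegral.integral_eq_integral_of_support_subset,
    intervalIntegral.integral_eq_integral_of_support_subset] at hparts
  · exact (Function.support_mul_subset_right _ _).trans ((subset_tsupport φ).trans hsupp)
  · exact (Function.support_mul_subset_right _ _).trans ((support_deriv_subset).trans hsupp)

theorem exists_continuous_ae_eq (h : HasWeakDeriv f f') :
    ∃ F, Continuous F ∧ f =ᵐ[volume] F := by
  obtain ⟨κ, hκ⟩ := h.exists_ae_eq_add_const (integral_primitive h.2.1)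
  have hri (a b : ℝ) : IntervalIntegrable f' volume a b :=
    (h.2.1.integrableOn_isCompact isCompact_uIcc).intervalIntegrable
  exact ⟨_, (intervalIntegral.continuous_primitive hri 0).add continuous_const, hκ⟩

theorem exists_hasDerivAt_ae_eq (h : HasWeakDeriv f f') {G : ℝ → ℝ} (hG : Continuous G)
    (hfG : f' =ᵐ[volume] G) : ∃ F, (∀ x, HasDerivAt F (G x) x) ∧ f =ᵐ[volume] F := by
  have hprim (x : ℝ) : HasDerivAt (fun x => ∫ t in (0 : ℝ)..x, G t) (G x) x :=
    (hG.integral_hasStrictDerivAt 0 x).hasDerivAt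
  obtain ⟨κ, hκ⟩ := (h.congr EventuallyEq.rfl hfG).exists_ae_eq_add_const (of_hasDerivAt hprim hG)
  exact ⟨_, fun x => (hprim x).add_const κ, hκ⟩

end HasWeakDeriv

/-! ### Sobolev spaces on the line -/

namespace IsTestFunction

variable {φ : ℝ → ℝ}

theorem iteratedDeriv (hφ : IsTestFunction φ) (n : ℕ) : IsTestFunction (iteratedDeriv n φ) := by
  induction n with
  | zero => rwa [iteratedDeriv_zero]
  | succ n ih => rw [iteratedDeriv_succ]; exact ih.deriv

theorem hasWeakDeriv_deriv (hφ : IsTestFunction φ) : HasWeakDeriv φ (_root_.deriv φ) :=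
  .of_hasDerivAt hφ.hasDerivAt hφ.deriv.continuous

theorem hasWeakDeriv_iteratedDeriv (hφ : IsTestFunction φ) (n : ℕ) :
    HasWeakDeriv (_root_.iteratedDeriv n φ) (_root_.iteratedDeriv (n + 1) φ) := by
  rw [iteratedDeriv_succ]
  exact (hφ.iteratedDeriv n).hasWeakDeriv_deriv

theorem memH (hφ : IsTestFunction φ) (n : ℕ) : MemH n φ := by
  induction n generalizing φ with
  | zero => exact hφ.memLp 2
  | succ n ih => exact ⟨hφ.memLp 2, _, hφ.hasWeakDeriv_deriv, ih hφ.deriv⟩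

theorem inner_toLp (hφ : IsTestFunction φ) (u : Lp ℝ 2 (volume : Measure ℝ)) :
    inner ℝ ((hφ.memLp 2).toLp φ) u = ∫ x, u x * φ x := by
  rw [L2.inner_def]
  exact integral_congr_ae ((hφ.memLp 2).coeFn_toLp.mono fun x hx => by simp [hx])

end IsTestFunction

theorem hasWeakDeriv_coeFn_iff {u v : Lp ℝ 2 (volume : Measure ℝ)} :
    HasWeakDeriv u v ↔ ∀ φ (hφ : IsTestFunction φ),
      inner ℝ ((hφ.deriv.memLp 2).toLp (deriv φ)) u = -inner ℝ ((hφ.memLp 2).toLp φ) v := by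
  have hinner (φ : ℝ → ℝ) (hφ : IsTestFunction φ) :
      inner ℝ ((hφ.deriv.memLp 2).toLp (deriv φ)) u = -inner ℝ ((hφ.memLp 2).toLp φ) v ↔
        ∫ x, u x * deriv φ x = -∫ x, v x * φ x := by
    rw [hφ.deriv.inner_toLp, hφ.inner_toLp]
  rw [forall₂_congr hinner]
  exact ⟨fun h φ hφ => h.integral_mul_deriv hφ, fun h =>
    ⟨(Lp.memLp u).locallyIntegrable one_le_two, (Lp.memLp v).locallyIntegrable one_le_two,
      fun φ hφ hs => h φ ⟨hφ, hs⟩⟩⟩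

/-- The Sobolev space `H^m(ℝ)`, realized as the closed space of all tuples `(u, u', …, u⁽ᵐ⁾)` of
classes in `L²(ℝ)`, each the weak derivative of the preceding one, with the Hilbert norm
`(∑ ‖u⁽ⁱ⁾‖²)^(1/2)`. -/
def sobolevSpace (m : ℕ) :
    Submodule ℝ (PiLp 2 fun _ : Fin (m + 1) => Lp ℝ 2 (volume : Measure ℝ)) where
  carrier := {u | ∀ i : Fin m, HasWeakDeriv (u i.castSucc) (u i.succ)}
  zero_mem' i := hasWeakDeriv_coeFn_iff.2 fun φ hφ => by simp
  add_mem' {u v} hu hv i := hasWeakDeriv_coeFn_iff.2 fun φ hφ => by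
    simp only [PiLp.add_apply, inner_add_right, hasWeakDeriv_coeFn_iff.1 (hu i) φ hφ,
      hasWeakDeriv_coeFn_iff.1 (hv i) φ hφ, neg_add]
  smul_mem' a u hu i := hasWeakDeriv_coeFn_iff.2 fun φ hφ => by
    simp only [PiLp.smul_apply, inner_smul_right, hasWeakDeriv_coeFn_iff.1 (hu i) φ hφ, mul_neg]

namespace sobolevSpace

variable {m : ℕ}

theorem isClosed : IsClosed (SetLike.coe (sobolevSpace m)) := by
  have hset : SetLike.coe (sobolevSpace m) =
      ⋂ (i : Fin m) (φ : ℝ → ℝ) (hφ : IsTestFunction φ),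
        {u | inner ℝ ((hφ.deriv.memLp 2).toLp (deriv φ)) (u i.castSucc) =
          -inner ℝ ((hφ.memLp 2).toLp φ) (u i.succ)} := by
    ext u
    simp only [Set.mem_iInter]
    exact forall_congr' fun i => hasWeakDeriv_coeFn_iff
  rw [hset]
  refine isClosed_iInter fun i => isClosed_iInter fun φ => isClosed_iInter fun hφ =>
    isClosed_eq ?_ ?_ <;> fun_prop

instance : CompleteSpace (sobolevSpace m) := isClosed.completeSpace_coe

/-- The `i`-th weak derivative as a bounded operator from `H^m(ℝ)` to `L²(ℝ)`. -/
noncomputable def derivL (i : Fin (m + 1)) :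
    sobolevSpace m →L[ℝ] Lp ℝ 2 (volume : Measure ℝ) :=
  (PiLp.proj 2 _ i).comp (sobolevSpace m).subtypeL

theorem hasWeakDeriv (u : sobolevSpace m) (i : Fin m) :
    HasWeakDeriv (derivL i.castSucc u) (derivL i.succ u) :=
  u.2 i

theorem inner_eq (u v : sobolevSpace m) :
    inner ℝ u v = ∑ i, ∫ x, derivL i u x * derivL i v x := by
  rw [Submodule.coe_inner, PiLp.inner_apply]
  refine Finset.sum_congr rfl fun i _ => ?_
  rw [L2.inner_def]
  exact integral_congr_ae (ae_of_all _ fun x => mul_comm _ _)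

theorem norm_sq_eq (u : sobolevSpace m) : ‖u‖ ^ 2 = ∑ i, ∫ x, derivL i u x ^ 2 := by
  rw [← real_inner_self_eq_norm_sq, inner_eq]
  simp only [sq]

theorem ext {u v : sobolevSpace m} (h : derivL 0 u = derivL 0 v) : u = v := by
  refine Subtype.ext (PiLp.ext fun i => ?_)
  induction i using Fin.induction with
  | zero => exact h
  | succ i ih =>
    exact Lp.ext ((hasWeakDeriv u i).unique
      ((hasWeakDeriv v i).congr (by rw [← show _ = derivL i.castSucc v from ih]; rfl) .rfl))

/-- The element of `H^m(ℝ)` given by square integrable functions `u, u', …, u⁽ᵐ⁾`. -/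
noncomputable def mk (u : Fin (m + 1) → ℝ → ℝ) (hu : ∀ i, MemLp (u i) 2)
    (hw : ∀ i : Fin m, HasWeakDeriv (u i.castSucc) (u i.succ)) : sobolevSpace m :=
  ⟨WithLp.toLp 2 fun i => (hu i).toLp (u i), fun i =>
    (hw i).congr (hu _).coeFn_toLp.symm (hu _).coeFn_toLp.symm⟩

theorem derivL_mk {u : Fin (m + 1) → ℝ → ℝ} (hu : ∀ i, MemLp (u i) 2)
    (hw : ∀ i : Fin m, HasWeakDeriv (u i.castSucc) (u i.succ)) (i : Fin (m + 1)) :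
    derivL i (mk u hu hw) =ᵐ[volume] u i :=
  (hu i).coeFn_toLp

end sobolevSpace

/-- A test function as an element of `H^m(ℝ)`. -/
noncomputable def IsTestFunction.toSobolev (m : ℕ) {φ : ℝ → ℝ} (hφ : IsTestFunction φ) :
    sobolevSpace m :=
  sobolevSpace.mk (fun i => _root_.iteratedDeriv i φ) (fun i => (hφ.iteratedDeriv i).memLp 2)
    fun i => hφ.hasWeakDeriv_iteratedDeriv i

theorem IsTestFunction.derivL_toSobolev {m : ℕ} {φ : ℝ → ℝ} (hφ : IsTestFunction φ)
    (i : Fin (m + 1)) :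
    sobolevSpace.derivL i (hφ.toSobolev m) =ᵐ[volume] _root_.iteratedDeriv i φ :=
  sobolevSpace.derivL_mk (u := fun i : Fin (m + 1) => _root_.iteratedDeriv i φ) _ _ i

section energyForm

variable {m : ℕ} {c d : Fin (m + 1) → ℝ → ℝ}

open sobolevSpace

/-- The energy form `(u, v) ↦ ∑ᵢ ∫ cᵢ u⁽ⁱ⁾ v⁽ⁱ⁾` on `H^m(ℝ)` with bounded coefficients `cᵢ`. -/
noncomputable def energyForm (c : Fin (m + 1) → ℝ → ℝ) (hc : ∀ i, MemLp (c i) ∞) :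
    sobolevSpace m →L[ℝ] sobolevSpace m →L[ℝ] ℝ :=
  ∑ i, (ContinuousLinearMap.precomp ℝ (derivL i)).comp
    ((ContinuousLinearMap.lpPairing volume 2 2 (.mul ℝ ℝ)).comp
      (((ContinuousLinearMap.mul ℝ ℝ).holderL volume ∞ 2 2 ((hc i).toLp (c i))).comp (derivL i)))

theorem energyForm_apply (hc : ∀ i, MemLp (c i) ∞) (u v : sobolevSpace m) :
    energyForm c hc u v = ∑ i, ∫ x, c i x * derivL i u x * derivL i v x := by
  simp only [energyForm, _root_.sum_apply, ContinuousLinearMap.comp_apply,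
    ContinuousLinearMap.precomp_apply, ContinuousLinearMap.lpPairing_eq_integral,
    ContinuousLinearMap.holderL_apply_apply, ContinuousLinearMap.mul_apply']
  refine Finset.sum_congr rfl fun i _ => integral_congr_ae ?_
  filter_upwards [(ContinuousLinearMap.mul ℝ ℝ).coeFn_holder (r := 2) ((hc i).toLp (c i))
    (derivL i u), (hc i).coeFn_toLp] with x hx hcx
  rw [hx, ContinuousLinearMap.mul_apply', hcx]

theorem energyForm_comm (hc : ∀ i, MemLp (c i) ∞) (u v : sobolevSpace m) :
    energyForm c hc u v = energyForm c hc v u := by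
  simp only [energyForm_apply, mul_right_comm]

theorem integrable_mul_derivL_mul {w : ℝ → ℝ} (hw : MemLp w ∞) (i j : Fin (m + 1))
    (u v : sobolevSpace m) : Integrable fun x => w x * derivL i u x * derivL j v x :=
  ((Lp.memLp _).mul hw (r := 2)).integrable_mul (Lp.memLp _)

theorem energyForm_add (hc : ∀ i, MemLp (c i) ∞) (hd : ∀ i, MemLp (d i) ∞) :
    energyForm (c + d) (fun i => (hc i).add (hd i)) = energyForm c hc + energyForm d hd := by
  ext u v
  simp only [_root_.add_apply, energyForm_apply, Pi.add_apply, add_mul, ← Finset.sum_add_distrib]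
  exact Finset.sum_congr rfl fun i _ =>
    integral_add (integrable_mul_derivL_mul (hc i) i i u v)
      (integrable_mul_derivL_mul (hd i) i i u v)

theorem energyForm_smul (s : ℝ) (hc : ∀ i, MemLp (c i) ∞) :
    energyForm (s • c) (fun i => (hc i).const_smul s) = s • energyForm c hc := by
  ext u v
  simp only [_root_.smul_apply, energyForm_apply, Pi.smul_apply, smul_eq_mul, mul_assoc,
    integral_const_mul, Finset.mul_sum]

theorem mul_norm_sq_le_energyForm (hc : ∀ i, MemLp (c i) ∞) {δ : ℝ} (hδ : ∀ i x, δ ≤ c i x)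
    (u : sobolevSpace m) : δ * ‖u‖ ^ 2 ≤ energyForm c hc u u := by
  rw [norm_sq_eq, energyForm_apply, Finset.mul_sum]
  refine Finset.sum_le_sum fun i _ => ?_
  rw [← integral_const_mul]
  refine integral_mono ((Lp.memLp _).integrable_sq.const_mul δ)
    (integrable_mul_derivL_mul (hc i) i i u u) fun x => ?_
  simpa only [mul_assoc, sq] using mul_le_mul_of_nonneg_right (hδ i x) (mul_self_nonneg _)

end energyForm

section Decay

variable {f f' : ℝ → ℝ}

theorem tendsto_cocompact_zero_of_memLp_two (hd : ∀ x, HasDerivAt f (f' x) x) (hf : MemLp f 2)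
    (hf' : MemLp f' 2) : Tendsto f (cocompact ℝ) (𝓝 0) := by
  have hsq (x : ℝ) : HasDerivAt (fun x => f x ^ 2) (2 * (f x * f' x)) x := by
    simpa [mul_assoc] using (hd x).fun_pow 2
  have hi : Integrable fun x => 2 * (f x * f' x) := (hf.integrable_mul hf').const_mul 2
  have hlim : Tendsto (fun x => f x ^ 2) (cocompact ℝ) (𝓝 0) := by
    rw [cocompact_eq_atBot_atTop, tendsto_sup]
    exact ⟨tendsto_zero_of_hasDerivAt_of_integrableOn_Iic (a := 0) (fun x _ => hsq x)
        hi.integrableOn hf.integrable_sq.integrableOn,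
      tendsto_zero_of_hasDerivAt_of_integrableOn_Ioi (a := 0) (fun x _ => hsq x)
        hi.integrableOn hf.integrable_sq.integrableOn⟩
  have hsqrt := (Real.continuous_sqrt.tendsto 0).comp hlim
  simp only [Function.comp_def, Real.sqrt_sq_eq_abs, Real.sqrt_zero] at hsqrt
  exact (tendsto_zero_iff_abs_tendsto_zero _).2 hsqrt

theorem sq_le_integral_sq_add_integral_sq (hd : ∀ x, HasDerivAt f (f' x) x) (hf : MemLp f 2)
    (hf' : MemLp f' 2) (x : ℝ) : f x ^ 2 ≤ (∫ x, f x ^ 2) + ∫ x, f' x ^ 2 := by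
  have hsq (y : ℝ) : HasDerivAt (fun x => f x ^ 2) (2 * (f y * f' y)) y := by
    simpa [mul_assoc] using (hd y).fun_pow 2
  have hi : Integrable fun x => 2 * (f x * f' x) := (hf.integrable_mul hf').const_mul 2
  have hs : Integrable fun x => f x ^ 2 + f' x ^ 2 := hf.integrable_sq.add hf'.integrable_sq
  have hlim : Tendsto (fun x => f x ^ 2) atBot (𝓝 0) := by
    simpa using ((tendsto_cocompact_zero_of_memLp_two hd hf hf').mono_left
      (cocompact_eq_atBot_atTop (α := ℝ) ▸ le_sup_left)).pow 2
  calc f x ^ 2 = ∫ y in Set.Iic x, 2 * (f y * f' y) := by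
        rw [integral_Iic_of_hasDerivAt_of_tendsto (hsq x).continuousAt.continuousWithinAt
          (fun y _ => hsq y) hi.integrableOn hlim, sub_zero]
    _ ≤ ∫ y in Set.Iic x, (f y ^ 2 + f' y ^ 2) :=
        integral_mono hi.integrableOn hs.integrableOn fun y => by
          simpa only [mul_assoc] using two_mul_le_add_sq (f y) (f' y)
    _ ≤ ∫ y, (f y ^ 2 + f' y ^ 2) :=
        setIntegral_le_integral hs (ae_of_all _ fun y => add_nonneg (sq_nonneg _) (sq_nonneg _))
    _ = _ := integral_add hf.integrable_sq hf'.integrable_sq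

end Decay

namespace sobolevSpace

/-- The subspace of `H^m(ℝ)` formed by the test functions. -/
def testSpace (m : ℕ) : Submodule ℝ (sobolevSpace m) where
  carrier := {u | ∃ φ, IsTestFunction φ ∧ derivL 0 u =ᵐ[volume] φ}
  zero_mem' := ⟨0, ⟨contDiff_const, HasCompactSupport.zero⟩, by
    simpa only [map_zero] using Lp.coeFn_zero ℝ 2 volume⟩
  add_mem' {u v} := by
    rintro ⟨φ, hφ, hu⟩ ⟨ψ, hψ, hv⟩
    refine ⟨φ + ψ, ⟨hφ.contDiff.add hψ.contDiff, hφ.hasCompactSupport.add hψ.hasCompactSupport⟩, ?_⟩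
    rw [map_add]
    exact (Lp.coeFn_add _ _).trans (hu.add hv)
  smul_mem' a u := by
    rintro ⟨φ, hφ, hu⟩
    refine ⟨a • φ, hφ.const_mul a, ?_⟩
    rw [map_smul]
    exact (Lp.coeFn_smul _ _).trans (hu.const_smul a)

theorem toSobolev_mem_testSpace {m : ℕ} {φ : ℝ → ℝ} (hφ : IsTestFunction φ) :
    hφ.toSobolev m ∈ testSpace m :=
  ⟨φ, hφ, hφ.derivL_toSobolev 0⟩

theorem exists_eq_toSobolev_of_mem_testSpace {m : ℕ} {u : sobolevSpace m} (hu : u ∈ testSpace m) :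
    ∃ (φ : ℝ → ℝ) (hφ : IsTestFunction φ), u = hφ.toSobolev m :=
  let ⟨φ, hφ, h⟩ := hu
  ⟨φ, hφ, ext (Lp.ext (h.trans (hφ.derivL_toSobolev 0).symm))⟩

theorem eq_zero_of_hasWeakDeriv (u : sobolevSpace 1)
    (h : HasWeakDeriv (derivL 1 u) (derivL 0 u)) : u = 0 := by
  obtain ⟨F₀, hF₀c, hF₀⟩ := (hasWeakDeriv u 0).exists_continuous_ae_eq
  obtain ⟨G, hG, huG⟩ := h.exists_hasDerivAt_ae_eq hF₀c hF₀
  have hGc : Continuous G := continuous_iff_continuousAt.2 fun x => (hG x).continuousAt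
  obtain ⟨F, hF, huF⟩ := (hasWeakDeriv u 0).exists_hasDerivAt_ae_eq hGc huG
  have hFc : Continuous F := continuous_iff_continuousAt.2 fun x => (hF x).continuousAt
  obtain rfl : F₀ = F := hF₀c.ae_eq_iff_eq volume hFc |>.1 (hF₀.symm.trans huF)
  have hFL : MemLp F₀ 2 := (Lp.memLp _).ae_eq huF
  have hGL : MemLp G 2 := (Lp.memLp _).ae_eq huG
  have hFF : Integrable fun x => F₀ x * F₀ x := hFL.integrable_mul hFL
  have hGG : Integrable fun x => G x * G x := hGL.integrable_mul hGL
  have hint : ∫ x, (G x * G x + F₀ x * F₀ x) = 0 :=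
    integral_eq_zero_of_hasDerivAt_of_integrable (fun x => (hF x).mul (hG x))
      (hGG.add hFF) (hFL.integrable_mul hGL)
  rw [integral_add hGG hFF, add_comm] at hint
  rw [← norm_eq_zero, ← sq_eq_zero_iff, norm_sq_eq, Fin.sum_univ_two, ← hint]
  simp only [← sq]
  exact congrArg₂ (· + ·) (integral_congr_ae (huF.pow_const 2))
    (integral_congr_ae (huG.pow_const 2))

theorem dense_testSpace_one : Dense (SetLike.coe (testSpace 1)) := by
  rw [Submodule.dense_iff_topologicalClosure_eq_top, Submodule.topologicalClosure_eq_top_iff,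
    Submodule.eq_bot_iff]
  intro n hn
  refine eq_zero_of_hasWeakDeriv n ⟨(Lp.memLp _).locallyIntegrable one_le_two,
    (Lp.memLp _).locallyIntegrable one_le_two, fun φ hφ hs => ?_⟩
  have hφ : IsTestFunction φ := ⟨hφ, hs⟩
  have horth := (Submodule.mem_orthogonal _ _).1 hn _ (toSobolev_mem_testSpace hφ)
  rw [inner_eq, Fin.sum_univ_two] at horth
  have hcomp (i : Fin 2) : ∫ x, derivL i (hφ.toSobolev 1) x * derivL i n x =
      ∫ x, derivL i n x * iteratedDeriv i φ x :=
    integral_congr_ae ((hφ.derivL_toSobolev i).mono fun x hx => by simp only [hx, mul_comm])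
  rw [hcomp, hcomp] at horth
  simp only [Fin.val_zero, iteratedDeriv_zero, Fin.val_one, iteratedDeriv_one] at horth
  linarith

/-- The continuous representative of the class `u`, which exists for `m ≥ 1`. -/
noncomputable def continuousRep {m : ℕ} (u : sobolevSpace (m + 1)) : ℝ → ℝ :=
  (hasWeakDeriv u 0).exists_continuous_ae_eq.choose

theorem continuous_continuousRep {m : ℕ} (u : sobolevSpace (m + 1)) :
    Continuous (continuousRep u) :=
  (hasWeakDeriv u 0).exists_continuous_ae_eq.choose_spec.1

theorem ae_eq_continuousRep {m : ℕ} (u : sobolevSpace (m + 1)) :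
    derivL 0 u =ᵐ[volume] continuousRep u :=
  (hasWeakDeriv u 0).exists_continuous_ae_eq.choose_spec.2

theorem continuousRep_eq {m : ℕ} {u : sobolevSpace (m + 1)} {F : ℝ → ℝ} (hF : Continuous F)
    (h : derivL 0 u =ᵐ[volume] F) : continuousRep u = F :=
  ((continuous_continuousRep u).ae_eq_iff_eq volume hF).1 ((ae_eq_continuousRep u).symm.trans h)

theorem sq_continuousRep_le (u : sobolevSpace 2) (x : ℝ) : continuousRep u x ^ 2 ≤ ‖u‖ ^ 2 := by
  obtain ⟨G, hG, huG⟩ := (hasWeakDeriv u 1).exists_continuous_ae_eq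
  obtain ⟨F, hF, huF⟩ := (hasWeakDeriv u 0).exists_hasDerivAt_ae_eq hG huG
  have hsob := sq_le_integral_sq_add_integral_sq hF ((Lp.memLp _).ae_eq huF)
    ((Lp.memLp _).ae_eq huG) x
  rw [continuousRep_eq (continuous_iff_continuousAt.2 fun x => (hF x).continuousAt) huF, norm_sq_eq,
    Fin.sum_univ_three]
  have hF2 : ∫ x, derivL 0 u x ^ 2 = ∫ x, F x ^ 2 := integral_congr_ae (huF.pow_const 2)
  have hG2 : ∫ x, derivL 1 u x ^ 2 = ∫ x, G x ^ 2 := integral_congr_ae (huG.pow_const 2)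
  rw [hF2, hG2]
  exact hsob.trans (le_add_of_nonneg_right (integral_nonneg fun x => sq_nonneg _))

/-- Evaluation of the continuous representative at `x` is a bounded functional on `H²(ℝ)`. -/
noncomputable def evalL (x : ℝ) : sobolevSpace 2 →L[ℝ] ℝ :=
  LinearMap.mkContinuous
    { toFun := fun u => continuousRep u x
      map_add' := fun u v => congrFun (continuousRep_eq
        ((continuous_continuousRep u).add (continuous_continuousRep v)) (by
          rw [map_add]
          exact (Lp.coeFn_add _ _).trans ((ae_eq_continuousRep u).add (ae_eq_continuousRep v)))) x
      map_smul' := fun a u => congrFun (continuousRep_eq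
        ((continuous_continuousRep u).const_smul a) (by
          rw [map_smul]
          exact (Lp.coeFn_smul _ _).trans ((ae_eq_continuousRep u).const_smul a))) x }
    1 fun u => by
      rw [one_mul]
      exact abs_le_of_sq_le_sq (sq_continuousRep_le u x) (norm_nonneg u)

/-- A weighted form of Rellich's theorem: the integrable weight supplies the compactness that the
embedding of `H²(ℝ)` into `L²(ℝ)` lacks. -/
theorem tendsto_integral_mul_sq {u : ℕ → sobolevSpace 2} {a : sobolevSpace 2} {C : ℝ}
    (hC : ∀ n, ‖u n‖ ≤ C)
    (hu : ∀ L : sobolevSpace 2 →L[ℝ] ℝ, Tendsto (fun n => L (u n)) atTop (𝓝 (L a)))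
    {w : ℝ → ℝ} (hw : Integrable w) :
    Tendsto (fun n => ∫ x, w x * derivL 0 (u n) x * derivL 0 (u n) x) atTop
      (𝓝 (∫ x, w x * derivL 0 a x * derivL 0 a x)) := by
  have hrep (v : sobolevSpace 2) : ∫ x, w x * derivL 0 v x * derivL 0 v x =
      ∫ x, w x * continuousRep v x ^ 2 :=
    integral_congr_ae ((ae_eq_continuousRep v).mono fun x hx => by simp only [hx]; ring)
  simp only [hrep]
  refine tendsto_integral_of_dominated_convergence (fun x => ‖w x‖ * C ^ 2)
    (fun n => hw.1.mul ((continuous_continuousRep (u n)).pow 2).aestronglyMeasurable)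
    (hw.norm.mul_const _) (fun n => ae_of_all _ fun x => ?_)
    (ae_of_all _ fun x => ((hu (evalL x)).pow 2).const_mul (w x))
  rw [norm_mul, Real.norm_of_nonneg (sq_nonneg (continuousRep (u n) x))]
  exact mul_le_mul_of_nonneg_left ((sq_continuousRep_le (u n) x).trans
    (pow_le_pow_left₀ (norm_nonneg _) (hC n) 2)) (norm_nonneg _)

end sobolevSpace

/-! ### Minimizers at the threshold -/

section Threshold

variable {V : Type*} [NormedAddCommGroup V]

set_option maxSynthPendingDepth 3 in
theorem exists_threshold [NormedSpace ℝ V] {T : ℝ → V →L[ℝ] V →L[ℝ] ℝ} (hT : Continuous T)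
    (h0 : ∃ u, T 0 u u < 0) {Λ : ℝ} (hΛ : 0 ≤ Λ) (hpos : ∀ u, 0 ≤ T Λ u u) :
    ∃ t, 0 < t ∧ (∀ u, 0 ≤ T t u u) ∧
      ∃ u : ℕ → V, (∀ n, ‖u n‖ = 1) ∧ Tendsto (fun n => T t (u n) (u n)) atTop (𝓝 0) := by
  set S : Set ℝ := {t | 0 ≤ t ∧ ∀ u, 0 ≤ T t u u}
  have hS_closed : IsClosed S := by
    simp only [S, Set.ofPred_and, Set.ofPred_forall]
    exact isClosed_Ici.inter (isClosed_iInter fun u => isClosed_le continuous_const (by fun_prop))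
  have hS_bdd : BddBelow S := ⟨0, fun t ht => ht.1⟩
  obtain ⟨hs0, hs⟩ : sInf S ∈ S := hS_closed.csInf_mem ⟨Λ, hΛ, hpos⟩ hS_bdd
  set s := sInf S
  have hs_pos : 0 < s := by
    refine hs0.lt_of_ne fun h => ?_
    obtain ⟨u, hu⟩ := h0
    exact hu.not_ge (h ▸ hs u)
  obtain ⟨t, -, ht, hts⟩ := exists_seq_strictMono_tendsto' hs_pos
  have hneg (n : ℕ) : ∃ u, ‖u‖ = 1 ∧ T (t n) u u < 0 := by
    have htS : t n ∉ S := notMem_of_lt_csInf (ht n).2 hS_bdd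
    obtain ⟨u, hu⟩ : ∃ u, T (t n) u u < 0 := by
      simpa [S, (ht n).1.le] using htS
    have hu0 : u ≠ 0 := by rintro rfl; simp at hu
    refine ⟨‖u‖⁻¹ • u, norm_smul_inv_norm hu0, ?_⟩
    simp only [map_smul, smul_apply, smul_eq_mul]
    have : 0 < ‖u‖⁻¹ := inv_pos.2 (norm_pos_iff.2 hu0)
    exact mul_neg_of_pos_of_neg this (mul_neg_of_pos_of_neg this hu)
  choose u hu1 hu using hneg
  refine ⟨s, hs_pos, hs, u, hu1, ?_⟩
  have hdiff : Tendsto (fun n => ‖T s - T (t n)‖) atTop (𝓝 0) := by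
    simpa using ((hT.tendsto s).comp hts).const_sub (T s) |>.norm
  refine squeeze_zero (fun n => hs (u n)) (fun n => ?_) hdiff
  calc T s (u n) (u n) ≤ (T s - T (t n)) (u n) (u n) := by
        simp only [sub_apply]; linarith [hu n]
    _ ≤ ‖T s - T (t n)‖ * ‖u n‖ * ‖u n‖ := (le_abs_self _).trans ((T s - T (t n)).le_opNorm₂ _ _)
    _ = ‖T s - T (t n)‖ := by simp [hu1]

theorem exists_subseq_tendsto_weakly [InnerProductSpace ℝ V] [CompleteSpace V]
    [TopologicalSpace.SeparableSpace V] {u : ℕ → V} {C : ℝ} (hu : ∀ n, ‖u n‖ ≤ C) :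
    ∃ (a : V) (σ : ℕ → ℕ), StrictMono σ ∧
      ∀ L : V →L[ℝ] ℝ, Tendsto (fun n => L (u (σ n))) atTop (𝓝 (L a)) := by
  have hball (n : ℕ) : StrongDual.toWeakDual (InnerProductSpace.toDual ℝ V (u n)) ∈
      WeakDual.toStrongDual ⁻¹' Metric.closedBall (0 : StrongDual ℝ V) C := by
    simpa using hu n
  obtain ⟨ℓ, -, σ, hσ, hlim⟩ := WeakDual.isSeqCompact_closedBall ℝ V 0 C hball
  refine ⟨(InnerProductSpace.toDual ℝ V).symm (WeakDual.toStrongDual ℓ), σ, hσ, fun L => ?_⟩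
  set w := (InnerProductSpace.toDual ℝ V).symm L
  have hriesz (v : V) : L v = InnerProductSpace.toDual ℝ V v w := by
    rw [InnerProductSpace.toDual_apply_apply, real_inner_comm, InnerProductSpace.toDual_symm_apply]
  simp only [hriesz, LinearIsometryEquiv.apply_symm_apply]
  exact ((WeakDual.eval_continuous w).tendsto ℓ).comp hlim

theorem exists_ne_zero_forall_apply_eq_zero [InnerProductSpace ℝ V] [CompleteSpace V]
    [TopologicalSpace.SeparableSpace V] {B : V →L[ℝ] V →L[ℝ] ℝ} (hsymm : ∀ u v, B u v = B v u)
    (hpos : ∀ u, 0 ≤ B u u) {q : V → ℝ} (hq0 : q 0 = 0)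
    (hq : ∀ (u : ℕ → V) (a : V), (∀ n, ‖u n‖ = 1) →
      (∀ L : V →L[ℝ] ℝ, Tendsto (fun n => L (u n)) atTop (𝓝 (L a))) →
      Tendsto (fun n => q (u n)) atTop (𝓝 (q a)))
    {δ : ℝ} (hδ : 0 < δ) (hcoer : ∀ u, δ * ‖u‖ ^ 2 ≤ B u u + q u)
    {u : ℕ → V} (hu : ∀ n, ‖u n‖ = 1) (hBu : Tendsto (fun n => B (u n) (u n)) atTop (𝓝 0)) :
    ∃ a ≠ 0, ∀ v, B a v = 0 := by
  obtain ⟨a, σ, hσ, hweak⟩ := exists_subseq_tendsto_weakly fun n => (hu n).le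
  have hBσ := hBu.comp hσ.tendsto_atTop
  refine ⟨a, ?_, fun v => ?_⟩
  · rintro rfl
    have hlim := hBσ.add (hq _ _ (fun n => hu (σ n)) hweak)
    rw [hq0, add_zero] at hlim
    refine hδ.not_ge (ge_of_tendsto' hlim fun n => ?_)
    simpa [hu] using hcoer (u (σ n))
  · have hsq : Tendsto (fun n => B (u (σ n)) v ^ 2) atTop (𝓝 0) := by
      refine squeeze_zero (fun n => sq_nonneg _) (fun n => ?_)
        (by simpa using hBσ.mul_const (B v v))
      exact LinearMap.BilinForm.apply_sq_le_of_symm (ContinuousLinearMap.toBilinForm B) hpos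
        ⟨hsymm⟩ (u (σ n)) v
    have hlim := (hweak (B.flip v)).pow 2
    exact pow_eq_zero_iff two_ne_zero |>.1 (tendsto_nhds_unique hlim hsq)

end Threshold

/-! ### Regularity and decay of solutions -/

section Regularity

theorem contDiff_of_forall_hasDerivAt {E : Type*} [NormedAddCommGroup E] [NormedSpace ℝ E]
    {y : ℝ → E} {G : ℝ × E → E} (hG : ContDiff ℝ ∞ G)
    (hy : ∀ x, HasDerivAt y (G (x, y x)) x) : ContDiff ℝ ∞ y := by
  have hderiv : deriv y = fun x => G (x, y x) := funext fun x => (hy x).deriv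
  refine contDiff_infty.2 fun n => ?_
  induction n with
  | zero => exact contDiff_zero.2 (continuous_iff_continuousAt.2 fun x => (hy x).continuousAt)
  | succ n ih =>
    rw [Nat.cast_succ, contDiff_succ_iff_deriv, hderiv]
    exact ⟨fun x => (hy x).differentiableAt, by simp,
      (hG.of_le (by exact_mod_cast le_top)).comp (contDiff_id.prodMk ih)⟩

theorem HasWeakDeriv.const_mul {f f' : ℝ → ℝ} (h : HasWeakDeriv f f') (c : ℝ) :
    HasWeakDeriv (fun x => c * f x) fun x => c * f' x := by
  refine ⟨h.1.smul c, h.2.1.smul c, fun φ hφ hs => ?_⟩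
  simp only [mul_assoc, integral_const_mul]
  rw [h.2.2 φ hφ hs, mul_neg]

theorem exists_hasWeakDeriv_sub {v w r R : ℝ → ℝ} (hv : LocallyIntegrable v)
    (hw : LocallyIntegrable w) (hR : HasWeakDeriv R r)
    (hweak : ∀ φ, IsTestFunction φ → (∫ x, v x * deriv (deriv φ) x) + (∫ x, w x * deriv φ x) +
      ∫ x, r x * φ x = 0) :
    ∃ κ, HasWeakDeriv v fun x => w x - (R x + κ) := by
  have hsub {φ : ℝ → ℝ} (hφ : IsTestFunction φ) :
      ∫ x, (w x - R x) * φ x = (∫ x, w x * φ x) - ∫ x, R x * φ x := by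
    simp only [sub_mul]
    exact integral_sub (hφ.integrable_mul hw) (hφ.integrable_mul hR.1)
  obtain ⟨κ, hκ⟩ := exists_forall_integral_mul_deriv_add_eq hv (hw.sub hR.1) fun φ hφ => by
    rw [← hweak φ hφ, add_assoc, ← neg_neg (∫ x, r x * φ x), ← hR.integral_mul_deriv hφ,
      ← sub_eq_add_neg]
    exact congrArg _ (hsub hφ.deriv)
  have hRκ : LocallyIntegrable fun x => R x + κ := hR.1.add (locallyIntegrable_const κ)
  refine ⟨κ, hv, hw.sub hRκ, fun φ hφ hs => ?_⟩
  have hφ : IsTestFunction φ := ⟨hφ, hs⟩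
  rw [eq_neg_iff_add_eq_zero, ← sub_eq_zero.2 (hκ φ hφ), add_sub_assoc]
  congr 1
  rw [← integral_const_mul, ← integral_sub (hφ.integrable_mul (hw.sub hR.1))
    (hφ.integrable.const_mul κ)]
  exact integral_congr_ae (ae_of_all _ fun x => by simp only [Pi.sub_apply]; ring)

variable {b : ℝ} {p q u₀ u₁ u₂ : ℝ → ℝ}

theorem exists_hasDerivAt_of_weak_solution (hb : b ≠ 0) (hp : Continuous p) (hq : Continuous q)
    (h₀₁ : HasWeakDeriv u₀ u₁) (h₁₂ : HasWeakDeriv u₁ u₂)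
    (hweak : ∀ φ, IsTestFunction φ → (∫ x, b * u₂ x * deriv (deriv φ) x) +
      (∫ x, p x * u₁ x * deriv φ x) + ∫ x, q x * u₀ x * φ x = 0) :
    ∃ F₀ F₁ F₂ Q : ℝ → ℝ, (u₀ =ᵐ[volume] F₀ ∧ u₁ =ᵐ[volume] F₁ ∧ u₂ =ᵐ[volume] F₂) ∧
      (∀ x, HasDerivAt F₀ (F₁ x) x) ∧ (∀ x, HasDerivAt F₁ (F₂ x) x) ∧
      (∀ x, HasDerivAt F₂ (b⁻¹ * (p x * F₁ x - Q x)) x) ∧ ∀ x, HasDerivAt Q (q x * F₀ x) x := by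
  have hcont {f f' : ℝ → ℝ} (h : ∀ x, HasDerivAt f (f' x) x) : Continuous f :=
    continuous_iff_continuousAt.2 fun x => (h x).continuousAt
  obtain ⟨F₁, hF₁c, hF₁⟩ := h₁₂.exists_continuous_ae_eq
  obtain ⟨F₀, hF₀d, hF₀⟩ := h₀₁.exists_hasDerivAt_ae_eq hF₁c hF₁
  have hqF₀ : Continuous fun x => q x * F₀ x := hq.mul (hcont hF₀d)
  set Q : ℝ → ℝ := fun x => ∫ t in (0 : ℝ)..x, q t * F₀ t
  have hQ (x : ℝ) : HasDerivAt Q (q x * F₀ x) x :=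
    (hqF₀.integral_hasStrictDerivAt 0 x).hasDerivAt
  have hae (φ : ℝ → ℝ) : ∫ x, p x * u₁ x * φ x = ∫ x, p x * F₁ x * φ x :=
    integral_congr_ae (hF₁.mono fun x hx => by simp only [hx])
  have hae' (φ : ℝ → ℝ) : ∫ x, q x * u₀ x * φ x = ∫ x, q x * F₀ x * φ x :=
    integral_congr_ae (hF₀.mono fun x hx => by simp only [hx])
  obtain ⟨κ, hκ⟩ := exists_hasWeakDeriv_sub (v := fun x => b * u₂ x)
    (w := fun x => p x * F₁ x) (h₁₂.2.1.smul b) (hp.mul hF₁c).locallyIntegrable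
    (.of_hasDerivAt hQ hqF₀) fun φ hφ => by rw [← hae, ← hae', hweak φ hφ]
  have h₂₃ : HasWeakDeriv u₂ fun x => b⁻¹ * (p x * F₁ x - (Q x + κ)) := by
    simpa only [inv_mul_cancel_left₀ hb] using hκ.const_mul b⁻¹
  obtain ⟨F₂, hF₂d, hF₂⟩ := h₂₃.exists_hasDerivAt_ae_eq
    (continuous_const.mul ((hp.mul hF₁c).sub ((hcont hQ).add continuous_const))) .rfl
  obtain ⟨G, hG, hG₁⟩ := h₁₂.exists_hasDerivAt_ae_eq (hcont hF₂d) hF₂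
  obtain rfl : G = F₁ := ((hcont hG).ae_eq_iff_eq volume hF₁c).1 (hG₁.symm.trans hF₁)
  exact ⟨F₀, G, F₂, fun x => Q x + κ, ⟨hF₀, hF₁, hF₂⟩, hF₀d, hG, hF₂d,
    fun x => (hQ x).add_const κ⟩

theorem exists_contDiff_solution_of_weak_solution (hb : b ≠ 0) (hp : ContDiff ℝ ∞ p)
    (hq : ContDiff ℝ ∞ q) (h₀₁ : HasWeakDeriv u₀ u₁) (h₁₂ : HasWeakDeriv u₁ u₂)
    (hweak : ∀ φ, IsTestFunction φ → (∫ x, b * u₂ x * deriv (deriv φ) x) +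
      (∫ x, p x * u₁ x * deriv φ x) + ∫ x, q x * u₀ x * φ x = 0) :
    ∃ ψ, ContDiff ℝ ∞ ψ ∧
      (u₀ =ᵐ[volume] ψ ∧ u₁ =ᵐ[volume] deriv ψ ∧ u₂ =ᵐ[volume] iteratedDeriv 2 ψ) ∧
      ∀ x, b * iteratedDeriv 4 ψ x - deriv (fun y => p y * deriv ψ y) x + q x * ψ x = 0 := by
  obtain ⟨F₀, F₁, F₂, Q, hae, hF₀, hF₁, hF₂, hQ⟩ :=
    exists_hasDerivAt_of_weak_solution hb hp.continuous hq.continuous h₀₁ h₁₂ hweak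
  have hsmooth : ContDiff ℝ ∞ fun x => (F₀ x, F₁ x, F₂ x, Q x) := by
    refine contDiff_of_forall_hasDerivAt (G := fun z : ℝ × ℝ × ℝ × ℝ × ℝ =>
      (z.2.2.1, z.2.2.2.1, b⁻¹ * (p z.1 * z.2.2.1 - z.2.2.2.2), q z.1 * z.2.1)) ?_ fun x =>
        (hF₀ x).prodMk ((hF₁ x).prodMk ((hF₂ x).prodMk (hQ x)))
    fun_prop
  have hd₁ : deriv F₀ = F₁ := funext fun x => (hF₀ x).deriv
  have hd₂ : iteratedDeriv 2 F₀ = F₂ := by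
    rw [iteratedDeriv_succ, iteratedDeriv_one, hd₁]; exact funext fun x => (hF₁ x).deriv
  have hd₃ : iteratedDeriv 3 F₀ = fun x => b⁻¹ * (p x * F₁ x - Q x) := by
    rw [iteratedDeriv_succ, hd₂]; exact funext fun x => (hF₂ x).deriv
  refine ⟨F₀, hsmooth.fst, ⟨hae.1, hd₁ ▸ hae.2.1, hd₂ ▸ hae.2.2⟩, fun x => ?_⟩
  have hpF₁ : HasDerivAt (fun y => p y * F₁ y) (deriv (fun y => p y * F₁ y) x) x :=
    ((hp.differentiable (by simp) x).mul (hF₁ x).differentiableAt).hasDerivAt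
  rw [iteratedDeriv_succ, hd₃, hd₁, ((hpF₁.fun_sub (hQ x)).const_mul b⁻¹).deriv,
    mul_inv_cancel_left₀ hb]
  ring

end Regularity

section Bootstrap

theorem exists_seq_tendsto_atTop_deriv_le_one {f f' : ℝ → ℝ} (hd : ∀ x, HasDerivAt f (f' x) x)
    (hf : Integrable f) : ∃ x : ℕ → ℝ, Tendsto x atTop atTop ∧ ∀ n, f' (x n) ≤ 1 := by
  refine exists_seq_forall_of_frequently (l := atTop) (p := fun x => f' x ≤ 1) fun hev => ?_
  obtain ⟨a, ha⟩ := eventually_atTop.1 hev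
  have hmono : MonotoneOn (fun x => f x - x) (Set.Ici a) :=
    monotoneOn_of_hasDerivWithinAt_nonneg (convex_Ici a)
      (fun x _ => ((hd x).continuousAt.sub continuousAt_id).continuousWithinAt)
      (fun x _ => ((hd x).sub (hasDerivAt_id x)).hasDerivWithinAt) fun x hx =>
        sub_nonneg.2 (not_le.1 (ha x (interior_subset hx))).le
  have hsub : Set.Ici (max a (a - f a + 1)) ⊆ {x | 1 ≤ ‖f x‖} := fun x hx => by
    have hx' := max_le_iff.1 (Set.mem_Ici.1 hx)
    have := hmono (Set.self_mem_Ici) hx'.1 hx'.1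
    exact (le_abs_self (f x)).trans' (by simp only at this; linarith)
  exact ((measure_mono hsub).trans_lt (hf.measure_norm_ge_lt_top one_pos)).ne Real.volume_Ici

theorem memLp_two_deriv_of_memLp_two {f f' f'' : ℝ → ℝ} (hd : ∀ x, HasDerivAt f (f' x) x)
    (hd' : ∀ x, HasDerivAt f' (f'' x) x) (hf : MemLp f 2) (hf'' : MemLp f'' 2) : MemLp f' 2 := by
  have hf'c : Continuous f' := continuous_iff_continuousAt.2 fun x => (hd' x).continuousAt
  have hsq (x : ℝ) : HasDerivAt (fun y => f y ^ 2) (2 * (f x * f' x)) x := by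
    simpa [mul_assoc] using (hd x).fun_pow 2
  have hff'' : Integrable fun x => f x * f'' x := hf.integrable_mul hf''
  have hf'sq (a b : ℝ) : IntervalIntegrable (fun x => f' x ^ 2) volume a b :=
    (hf'c.pow 2).intervalIntegrable a b
  obtain ⟨y, hy, hy'⟩ := exists_seq_tendsto_atTop_deriv_le_one hsq hf.integrable_sq
  obtain ⟨z, hz, hz'⟩ := exists_seq_tendsto_atTop_deriv_le_one
    (fun x => (hsq (-x)).scomp x (hasDerivAt_neg x)) hf.integrable_sq.comp_neg
  rw [memLp_two_iff_integrable_sq hf'c.aestronglyMeasurable]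
  refine integrable_of_intervalIntegral_norm_bounded (1 + ∫ x, |f x * f'' x|)
    (fun n => (hf'sq _ _).1) (tendsto_neg_atTop_atBot.comp hz) hy ?_
  filter_upwards [hy.eventually_ge_atTop 0, hz.eventually_ge_atTop 0] with n hyn hzn
  have hle : -z n ≤ y n := by linarith
  have hparts : (∫ x in -z n..y n, f' x ^ 2) + ∫ x in -z n..y n, f x * f'' x =
      f (y n) * f' (y n) - f (-z n) * f' (-z n) := by
    rw [← intervalIntegral.integral_add (hf'sq _ _) hff''.intervalIntegrable]
    exact intervalIntegral.integral_eq_sub_of_hasDerivAt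
      (fun x _ => ((hd x).mul (hd' x)).congr_deriv (by ring))
      ((hf'sq _ _).add hff''.intervalIntegrable)
  have habs : -∫ x in -z n..y n, f x * f'' x ≤ ∫ x, |f x * f'' x| :=
    (neg_le_abs _).trans <| (intervalIntegral.abs_integral_le_integral_abs hle).trans <| by
      rw [intervalIntegral.integral_of_le hle]
      exact setIntegral_le_integral hff''.abs (ae_of_all _ fun x => abs_nonneg _)
  have hyn' := hy' n
  have hzn' := hz' n
  simp only [Function.comp_apply, Real.norm_eq_abs, abs_sq, neg_smul, one_smul] at hzn' ⊢
  linarith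

theorem memLp_iteratedDeriv_mul {c f : ℝ → ℝ} {r : ℝ≥0∞} (hc : ContDiff ℝ ∞ c)
    (hf : ContDiff ℝ ∞ f) (hcb : ∀ n, MemLp (iteratedDeriv n c) ∞) {n : ℕ}
    (hfr : ∀ j ≤ n, MemLp (iteratedDeriv j f) r) :
    MemLp (iteratedDeriv n fun x => c x * f x) r := by
  have hleibniz : (iteratedDeriv n fun x => c x * f x) = fun x => ∑ i ∈ Finset.range (n + 1),
      n.choose i * iteratedDeriv i c x * iteratedDeriv (n - i) f x :=
    funext fun x => iteratedDeriv_fun_mul (contDiff_infty.1 hc n).contDiffAt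
      (contDiff_infty.1 hf n).contDiffAt
  rw [hleibniz]
  exact memLp_finsetSum _ fun i _ =>
    (hfr (n - i) (Nat.sub_le n i)).mul ((hcb i).const_mul _)

section Solution

variable {b : ℝ} {p q ψ : ℝ → ℝ}

theorem memLp_iteratedDeriv_add_four_of_solution {r : ℝ≥0∞} (hb : b ≠ 0) (hp : ContDiff ℝ ∞ p)
    (hq : ContDiff ℝ ∞ q) (hpb : ∀ n, MemLp (iteratedDeriv n p) ∞)
    (hqb : ∀ n, MemLp (iteratedDeriv n q) ∞) (hψ : ContDiff ℝ ∞ ψ)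
    (hode : ∀ x, b * iteratedDeriv 4 ψ x - deriv (fun y => p y * deriv ψ y) x + q x * ψ x = 0)
    {n : ℕ} (hn : ∀ j ≤ n + 2, MemLp (iteratedDeriv j ψ) r) :
    MemLp (iteratedDeriv (n + 4) ψ) r := by
  have hψ' : ContDiff ℝ ∞ (deriv ψ) := (contDiff_infty_iff_deriv.1 hψ).2
  have hpψ' : ContDiff ℝ ∞ (deriv fun y => p y * deriv ψ y) :=
    (contDiff_infty_iff_deriv.1 (hp.mul hψ')).2
  have hsolve : iteratedDeriv 4 ψ =
      fun x => b⁻¹ * (deriv (fun y => p y * deriv ψ y) x - q x * ψ x) :=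
    funext fun x => by rw [eq_inv_mul_iff_mul_eq₀ hb]; linarith [hode x]
  have hderiv : iteratedDeriv (n + 4) ψ = fun x => b⁻¹ *
      (iteratedDeriv (n + 1) (fun y => p y * deriv ψ y) x -
        iteratedDeriv n (fun y => q y * ψ y) x) := by
    rw [iteratedDeriv_eq_iterate, Function.iterate_add_apply, ← iteratedDeriv_eq_iterate,
      ← iteratedDeriv_eq_iterate, hsolve]
    funext x
    rw [iteratedDeriv_const_mul_field, iteratedDeriv_fun_sub (contDiff_infty.1 hpψ' n).contDiffAt
      (contDiff_infty.1 (hq.mul hψ) n).contDiffAt, ← iteratedDeriv_succ']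
  rw [hderiv]
  refine ((memLp_iteratedDeriv_mul hp hψ' hpb fun j hj => ?_).sub
    (memLp_iteratedDeriv_mul hq hψ hqb fun j hj => hn j (by omega))).const_mul _
  rw [← iteratedDeriv_succ']
  exact hn _ (by omega)

theorem memLp_two_iteratedDeriv_of_solution (hb : b ≠ 0) (hp : ContDiff ℝ ∞ p)
    (hq : ContDiff ℝ ∞ q) (hpb : ∀ n, MemLp (iteratedDeriv n p) ∞)
    (hqb : ∀ n, MemLp (iteratedDeriv n q) ∞) (hψ : ContDiff ℝ ∞ ψ)
    (hode : ∀ x, b * iteratedDeriv 4 ψ x - deriv (fun y => p y * deriv ψ y) x + q x * ψ x = 0)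
    (h2 : ∀ j ≤ 2, MemLp (iteratedDeriv j ψ) 2) (n : ℕ) : MemLp (iteratedDeriv n ψ) 2 := by
  have hd (k : ℕ) (x : ℝ) : HasDerivAt (iteratedDeriv k ψ) (iteratedDeriv (k + 1) ψ x) x := by
    rw [iteratedDeriv_succ]
    exact (hψ.differentiable_iteratedDeriv k (by exact_mod_cast ENat.natCast_lt_top k) x).hasDerivAt
  suffices ∀ k, ∀ j ≤ k + 2, MemLp (iteratedDeriv j ψ) 2 from this n n (Nat.le_add_right n 2)
  intro k
  induction k with
  | zero => exact h2
  | succ k ih =>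
    intro j hj
    rcases Nat.le_succ_iff.1 hj with hj | rfl
    · exact ih j hj
    · exact memLp_two_deriv_of_memLp_two (hd (k + 2)) (hd (k + 3)) (ih _ le_rfl)
        (memLp_iteratedDeriv_add_four_of_solution hb hp hq hpb hqb hψ hode ih)

end Solution

theorem memHInfty_of_forall_memLp_iteratedDeriv {f : ℝ → ℝ} (hf : ContDiff ℝ ∞ f)
    (h : ∀ n, MemLp (iteratedDeriv n f) 2) : MemHInfty f := by
  intro k
  induction k generalizing f with
  | zero => exact iteratedDeriv_zero (f := f) ▸ h 0
  | succ k ih =>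
    obtain ⟨hfd, hf'⟩ := contDiff_infty_iff_deriv.1 hf
    refine ⟨by simpa only [iteratedDeriv_zero] using h 0, deriv f,
      .of_hasDerivAt (fun x => (hfd x).hasDerivAt) hf'.continuous, ih hf' fun n => ?_⟩
    rw [← iteratedDeriv_succ']
    exact h (n + 1)

theorem vanishesAtInfinity_of_forall_memLp_iteratedDeriv {f : ℝ → ℝ} (hf : ContDiff ℝ ∞ f)
    (h : ∀ n, MemLp (iteratedDeriv n f) 2) : VanishesAtInfinity f := by
  obtain ⟨hfd, hf'⟩ := contDiff_infty_iff_deriv.1 hf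
  have h0 : MemLp f 2 := by simpa only [iteratedDeriv_zero] using h 0
  have h1 : MemLp (deriv f) 2 := by simpa only [iteratedDeriv_one] using h 1
  have h2 : MemLp (deriv (deriv f)) 2 := by
    simpa only [iteratedDeriv_succ, iteratedDeriv_zero] using h 2
  have hlim := tendsto_cocompact_zero_of_memLp_two (fun x => (hfd x).hasDerivAt) h0 h1
  have hlim' := tendsto_cocompact_zero_of_memLp_two
    (fun x => (hf'.differentiable (by simp) x).hasDerivAt) h1 h2
  rw [cocompact_eq_atBot_atTop, tendsto_sup] at hlim hlim'
  exact ⟨hlim.1, hlim'.1, hlim.2, hlim'.2⟩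

end Bootstrap

/-! ### The growth form -/

open sobolevSpace

theorem IsRTProfile.isTestFunction_deriv {ρ : ℝ → ℝ} (hρ : IsRTProfile ρ) :
    IsTestFunction (deriv ρ) :=
  ⟨(contDiff_infty_iff_deriv.1 hρ.smooth).2, hρ.compactSupport_deriv⟩

/-- The coefficients `c₀, c₁, c₂` for which the equation with eigenvalue parameter `lam` reads
`(c₂ ψ'')'' - (c₁ ψ')' + c₀ ψ = 0`. Here `k` is the modulus of the frequency, and the magnetic term
is `a₀ ψ - a₁ ψ'' + a₂ ψ''''`. -/
noncomputable def growthCoeff (ρ : ℝ → ℝ) (μ g k : ℝ) (a : Fin 3 → ℝ) (lam : ℝ) :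
    Fin 3 → ℝ → ℝ :=
  ![fun x => lam ^ 2 * k ^ 2 * ρ x + (lam * μ * k ^ 4 + a 0) - g * k ^ 2 * deriv ρ x,
    fun x => lam ^ 2 * ρ x + (2 * lam * μ * k ^ 2 + a 1),
    fun _ => lam * μ + a 2]

section GrowthForm

variable {ρ : ℝ → ℝ} {μ g k lam : ℝ} {a : Fin 3 → ℝ}

theorem memLp_growthCoeff (hρ : IsRTProfile ρ) (μ g k : ℝ) (a : Fin 3 → ℝ) (lam : ℝ) (i : Fin 3) :
    MemLp (growthCoeff ρ μ g k a lam i) ∞ := by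
  fin_cases i
  · exact ((hρ.bounded.const_mul _).add (memLp_top_const _)).sub
      ((hρ.isTestFunction_deriv.memLp ∞).const_mul _)
  · exact (hρ.bounded.const_mul _).add (memLp_top_const _)
  · exact memLp_top_const _

/-- The bilinear form of the equation with eigenvalue parameter `lam`; the growth rate is the
largest `lam` for which it has a nontrivial kernel. -/
noncomputable def growthForm (hρ : IsRTProfile ρ) (μ g k : ℝ) (a : Fin 3 → ℝ) (lam : ℝ) :
    sobolevSpace 2 →L[ℝ] sobolevSpace 2 →L[ℝ] ℝ :=
  energyForm (growthCoeff ρ μ g k a lam) (memLp_growthCoeff hρ μ g k a lam)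

set_option maxSynthPendingDepth 3 in
theorem continuous_growthForm (hρ : IsRTProfile ρ) (μ g k : ℝ) (a : Fin 3 → ℝ) :
    Continuous (growthForm hρ μ g k a) := by
  set viscous : Fin 3 → ℝ → ℝ := fun i _ => ![μ * k ^ 4, 2 * μ * k ^ 2, μ] i
  have hviscous (i : Fin 3) : MemLp (viscous i) ∞ := memLp_top_const _
  have hcoeff (lam : ℝ) : growthCoeff ρ μ g k a lam =
      lam ^ 2 • growthCoeff ρ 0 0 k 0 1 + lam • viscous + growthCoeff ρ μ g k a 0 := by
    ext i x
    simp only [Pi.add_apply, Pi.smul_apply, smul_eq_mul, viscous]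
    fin_cases i <;> simp [growthCoeff] <;> ring
  have hform (lam : ℝ) : growthForm hρ μ g k a lam =
      lam ^ 2 • growthForm hρ 0 0 k 0 1 + lam • energyForm viscous hviscous +
        growthForm hρ μ g k a 0 := by
    simp only [growthForm, ← energyForm_smul, ← energyForm_add, ← hcoeff lam]
  rw [funext hform]
  fun_prop

theorem growthForm_nonneg (hρ : IsRTProfile ρ) (ha : ∀ i, 0 ≤ a i) (hμ : 0 ≤ μ) (hlam : 0 ≤ lam)
    (h : ∀ x, g * deriv ρ x ≤ lam * μ * k ^ 2) (u : sobolevSpace 2) :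
    0 ≤ growthForm hρ μ g k a lam u u := by
  obtain ⟨c, hc, hcρ⟩ := hρ.inf_pos
  have hρ0 (x : ℝ) : 0 ≤ ρ x := hc.le.trans (hcρ x)
  have hcoeff (i : Fin 3) (x : ℝ) : 0 ≤ growthCoeff ρ μ g k a lam i x := by
    have hρx := hρ0 x
    have h0 := ha 0
    have h1 := ha 1
    have h2 := ha 2
    fin_cases i
    · have hk : k ^ 2 * (g * deriv ρ x) ≤ k ^ 2 * (lam * μ * k ^ 2) :=
        mul_le_mul_of_nonneg_left (h x) (sq_nonneg k)
      have hN : 0 ≤ lam ^ 2 * k ^ 2 * ρ x := by positivity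
      simp only [growthCoeff, Fin.zero_eta, Matrix.cons_val_zero]
      linarith
    · simp only [growthCoeff, Fin.mk_one, Matrix.cons_val_one, Matrix.cons_val_zero]
      positivity
    · simp only [growthCoeff, Fin.reduceFinMk, Matrix.cons_val]
      positivity
  have hle := mul_norm_sq_le_energyForm (memLp_growthCoeff hρ μ g k a lam) hcoeff u
  rwa [zero_mul] at hle

theorem growthForm_add_integral (hρ : IsRTProfile ρ) (u : sobolevSpace 2) :
    growthForm hρ μ g k a lam u u + ∫ x, g * k ^ 2 * deriv ρ x * derivL 0 u x * derivL 0 u x =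
      growthForm hρ μ 0 k a lam u u := by
  have hw : MemLp (fun x => g * k ^ 2 * deriv ρ x) ∞ :=
    (hρ.isTestFunction_deriv.memLp ∞).const_mul _
  have h0 : (∫ x, growthCoeff ρ μ g k a lam 0 x * derivL 0 u x * derivL 0 u x) +
      ∫ x, g * k ^ 2 * deriv ρ x * derivL 0 u x * derivL 0 u x =
        ∫ x, growthCoeff ρ μ 0 k a lam 0 x * derivL 0 u x * derivL 0 u x := by
    rw [← integral_add (integrable_mul_derivL_mul (memLp_growthCoeff hρ μ g k a lam 0) 0 0 u u)
      (integrable_mul_derivL_mul hw 0 0 u u)]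
    refine integral_congr_ae (ae_of_all _ fun x => ?_)
    simp only [growthCoeff, Matrix.cons_val_zero]
    ring
  rw [growthForm, growthForm, energyForm_apply, energyForm_apply, Fin.sum_univ_succ,
    Fin.sum_univ_succ, add_right_comm, h0]
  rfl

theorem growthForm_coercive (hρ : IsRTProfile ρ) (ha : ∀ i, 0 ≤ a i) (hμ : 0 < μ) (hk : 0 < k)
    (hlam : 0 < lam) : ∃ δ > 0, ∀ u, δ * ‖u‖ ^ 2 ≤ growthForm hρ μ 0 k a lam u u := by
  obtain ⟨c, hc, hcρ⟩ := hρ.inf_pos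
  refine ⟨lam * μ * min (k ^ 4) (min (2 * k ^ 2) 1), by positivity,
    mul_norm_sq_le_energyForm (memLp_growthCoeff hρ μ 0 k a lam) fun i x => ?_⟩
  have hρx : 0 ≤ ρ x := hc.le.trans (hcρ x)
  have hN : 0 ≤ lam ^ 2 * k ^ 2 * ρ x := by positivity
  have hN' : 0 ≤ lam ^ 2 * ρ x := by positivity
  have hlm : 0 ≤ lam * μ := by positivity
  have h0 := ha 0
  have h1 := ha 1
  have h2 := ha 2
  fin_cases i
  · have := mul_le_mul_of_nonneg_left (min_le_left (k ^ 4) (min (2 * k ^ 2) 1)) hlm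
    simp only [growthCoeff, Fin.zero_eta, Matrix.cons_val_zero]
    linarith
  · have := mul_le_mul_of_nonneg_left
      ((min_le_right (k ^ 4) _).trans (min_le_left (2 * k ^ 2) 1)) hlm
    simp only [growthCoeff, Fin.mk_one, Matrix.cons_val_one, Matrix.cons_val_zero]
    linarith
  · have := mul_le_mul_of_nonneg_left
      ((min_le_right (k ^ 4) _).trans (min_le_right (2 * k ^ 2) 1)) hlm
    simp only [growthCoeff, Fin.reduceFinMk, Matrix.cons_val]
    linarith

theorem growthForm_comm (hρ : IsRTProfile ρ) (u v : sobolevSpace 2) :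
    growthForm hρ μ g k a lam u v = growthForm hρ μ g k a lam v u :=
  energyForm_comm _ u v

end GrowthForm

instance sobolevSpace.instSeparableSpace (m : ℕ) :
    TopologicalSpace.SeparableSpace (sobolevSpace m) := by
  have : Fact ((2 : ℝ≥0∞) ≠ ⊤) := ⟨ENNReal.ofNat_ne_top⟩
  have : SecondCountableTopology (PiLp 2 fun _ : Fin (m + 1) => Lp ℝ 2 (volume : Measure ℝ)) :=
    (PiLp.homeomorph 2 _).secondCountableTopology
  infer_instance

theorem exists_growthForm_eq_zero {ρ : ℝ → ℝ} (hρ : IsRTProfile ρ) {μ g k : ℝ} {a : Fin 3 → ℝ}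
    (hμ : 0 < μ) (hk : 0 < k) (ha : ∀ i, 0 ≤ a i)
    (hneg : ∃ u, growthForm hρ μ g k a 0 u u < 0) :
    ∃ lam > 0, ∃ u ≠ 0, ∀ v, growthForm hρ μ g k a lam u v = 0 := by
  have hρ' := hρ.isTestFunction_deriv
  obtain ⟨C, hC⟩ := (hρ'.hasCompactSupport.exists_bound_of_continuous hρ'.continuous)
  have hΛ : 0 ≤ |g| * C / (μ * k ^ 2) := by
    have := (norm_nonneg _).trans (hC 0)
    positivity
  have hlarge (x : ℝ) : g * deriv ρ x ≤ |g| * C / (μ * k ^ 2) * μ * k ^ 2 := by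
    rw [mul_assoc, div_mul_cancel₀ _ (by positivity)]
    exact (le_abs_self _).trans (by rw [abs_mul]; gcongr; exact hC x)
  obtain ⟨lam, hlam, hpos, u, hu, hlim⟩ := exists_threshold (continuous_growthForm hρ μ g k a)
    hneg hΛ (growthForm_nonneg hρ ha hμ.le hΛ hlarge)
  obtain ⟨δ, hδ, hcoer⟩ := growthForm_coercive hρ ha hμ hk hlam
  refine ⟨lam, hlam, exists_ne_zero_forall_apply_eq_zero (growthForm_comm hρ) hpos
    (q := fun u => ∫ x, g * k ^ 2 * deriv ρ x * derivL 0 u x * derivL 0 u x) ?_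
    (fun u a hu hlim => tendsto_integral_mul_sq (fun n => (hu n).le) hlim
      (hρ'.integrable.const_mul _)) hδ
    (fun u => (hcoer u).trans_eq (growthForm_add_integral hρ u).symm) hu hlim⟩
  simp

theorem integral_inertia_pos {ρ : ℝ → ℝ} (hρ : IsRTProfile ρ) {k : ℝ} (hk : k ≠ 0)
    {u : sobolevSpace 2} (hu : u ≠ 0) :
    0 < ∫ x, ρ x * (k ^ 2 * derivL 0 u x ^ 2 + derivL 1 u x ^ 2) := by
  obtain ⟨c, hc, hcρ⟩ := hρ.inf_pos
  have hu0 : 0 < ∫ x, derivL 0 u x ^ 2 := by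
    have hinner : ∫ x, derivL 0 u x ^ 2 = inner ℝ (derivL 0 u) (derivL 0 u) := by
      rw [L2.inner_def]
      exact integral_congr_ae (ae_of_all _ fun x => sq _)
    rw [hinner, real_inner_self_pos]
    exact fun h => hu (sobolevSpace.ext (h.trans (map_zero _).symm))
  have hsq (i : Fin 3) : Integrable fun x => derivL i u x ^ 2 := (Lp.memLp _).integrable_sq
  have hsum : Integrable fun x => k ^ 2 * derivL 0 u x ^ 2 + derivL 1 u x ^ 2 :=
    ((hsq 0).const_mul _).add (hsq 1)
  calc 0 < c * k ^ 2 * ∫ x, derivL 0 u x ^ 2 := by positivity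
    _ = ∫ x, c * k ^ 2 * derivL 0 u x ^ 2 := (integral_const_mul _ _).symm
    _ ≤ ∫ x, ρ x * (k ^ 2 * derivL 0 u x ^ 2 + derivL 1 u x ^ 2) := by
      refine integral_mono ((hsq 0).const_mul _) (hsum.mul_of_top_right hρ.bounded) fun x => ?_
      rw [mul_assoc]
      exact mul_le_mul (hcρ x) (le_add_of_nonneg_right (sq_nonneg _)) (by positivity)
        (hc.le.trans (hcρ x))

theorem exists_smul_integral_inertia_eq_one {ρ : ℝ → ℝ} (hρ : IsRTProfile ρ) {k : ℝ} (hk : k ≠ 0)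
    {u : sobolevSpace 2} (hu : u ≠ 0) :
    ∃ s : ℝ, ∫ x, ρ x * (k ^ 2 * derivL 0 (s • u) x ^ 2 + derivL 1 (s • u) x ^ 2) = 1 := by
  have hN := integral_inertia_pos hρ hk hu
  set N := ∫ x, ρ x * (k ^ 2 * derivL 0 u x ^ 2 + derivL 1 u x ^ 2)
  refine ⟨(√N)⁻¹, ?_⟩
  have hscale : (fun x => ρ x * (k ^ 2 * derivL 0 ((√N)⁻¹ • u) x ^ 2 + derivL 1 ((√N)⁻¹ • u) x ^ 2))
      =ᵐ[volume] fun x => N⁻¹ * (ρ x * (k ^ 2 * derivL 0 u x ^ 2 + derivL 1 u x ^ 2)) := by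
    simp only [map_smul]
    filter_upwards [Lp.coeFn_smul (√N)⁻¹ (derivL 0 u), Lp.coeFn_smul (√N)⁻¹ (derivL 1 u)]
      with x h0 h1
    rw [h0, h1]
    simp only [Pi.smul_apply, smul_eq_mul, mul_pow, inv_pow, Real.sq_sqrt hN.le]
    ring
  rw [integral_congr_ae hscale, integral_const_mul, inv_mul_cancel₀ hN.ne']

theorem memLp_top_iteratedDeriv {c : ℝ → ℝ} (hc : MemLp c ∞) (hc' : IsTestFunction (deriv c))
    (n : ℕ) : MemLp (iteratedDeriv n c) ⊤ := by
  cases n with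
  | zero => rwa [iteratedDeriv_zero]
  | succ n => rw [iteratedDeriv_succ']; exact (hc'.iteratedDeriv n).memLp ⊤

theorem contDiff_growthCoeff {ρ : ℝ → ℝ} (hρ : IsRTProfile ρ) (μ g k : ℝ) (a : Fin 3 → ℝ)
    (lam : ℝ) (i : Fin 3) : ContDiff ℝ ∞ (growthCoeff ρ μ g k a lam i) := by
  have h := hρ.smooth
  have h' := hρ.isTestFunction_deriv.contDiff
  fin_cases i
  · exact ((contDiff_const.mul h).add contDiff_const).sub (contDiff_const.mul h')
  · exact (contDiff_const.mul h).add contDiff_const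
  · exact contDiff_const

theorem isTestFunction_deriv_growthCoeff {ρ : ℝ → ℝ} (hρ : IsRTProfile ρ) (μ g k : ℝ)
    (a : Fin 3 → ℝ) (lam : ℝ) (i : Fin 3) :
    IsTestFunction (deriv (growthCoeff ρ μ g k a lam i)) := by
  have hd (x : ℝ) : HasDerivAt ρ (deriv ρ x) x :=
    ((contDiff_infty_iff_deriv.1 hρ.smooth).1 x).hasDerivAt
  have hρ' := hρ.isTestFunction_deriv
  fin_cases i
  · convert! (hρ'.const_mul (lam ^ 2 * k ^ 2)).sub (hρ'.deriv.const_mul (g * k ^ 2)) using 1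
    exact funext fun x => ((((hd x).const_mul _).add_const _).sub
      ((hρ'.hasDerivAt x).const_mul _)).deriv
  · convert! hρ'.const_mul (lam ^ 2) using 1
    exact funext fun x => (((hd x).const_mul _).add_const _).deriv
  · convert! hρ'.const_mul 0 using 1
    exact funext fun x => by simp [growthCoeff]

theorem integral_growthCoeff_of_growthForm_eq_zero {ρ : ℝ → ℝ} {hρ : IsRTProfile ρ} {μ g k lam : ℝ}
    {a : Fin 3 → ℝ} {u : sobolevSpace 2} (hu : ∀ v, growthForm hρ μ g k a lam u v = 0)
    {φ : ℝ → ℝ} (hφ : IsTestFunction φ) :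
    (∫ x, (lam * μ + a 2) * derivL 2 u x * deriv (deriv φ) x) +
      (∫ x, growthCoeff ρ μ g k a lam 1 x * derivL 1 u x * deriv φ x) +
      ∫ x, growthCoeff ρ μ g k a lam 0 x * derivL 0 u x * φ x = 0 := by
  have hpair (i : Fin 3) {f : ℝ → ℝ} (hf : iteratedDeriv i φ = f) :
      ∫ x, growthCoeff ρ μ g k a lam i x * derivL i u x * derivL i (hφ.toSobolev 2) x =
        ∫ x, growthCoeff ρ μ g k a lam i x * derivL i u x * f x :=
    integral_congr_ae ((hφ.derivL_toSobolev i).mono fun x hx => by simp only [hx, ← hf])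
  have h := hu (hφ.toSobolev 2)
  rw [growthForm, energyForm_apply, Fin.sum_univ_three, hpair 0 iteratedDeriv_zero,
    hpair 1 iteratedDeriv_one,
    hpair 2 (f := deriv (deriv φ)) (iteratedDeriv_succ.trans (by rw [iteratedDeriv_one]))] at h
  rwa [add_right_comm, add_rotate]

theorem exists_contDiff_of_growthForm_eq_zero {ρ : ℝ → ℝ} {hρ : IsRTProfile ρ} {μ g k lam : ℝ}
    {a : Fin 3 → ℝ} (hb : lam * μ + a 2 ≠ 0) {u : sobolevSpace 2}
    (hu : ∀ v, growthForm hρ μ g k a lam u v = 0) :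
    ∃ ψ, ContDiff ℝ ∞ ψ ∧ (∀ n, MemLp (iteratedDeriv n ψ) 2) ∧
      (derivL 0 u =ᵐ[volume] ψ ∧ derivL 1 u =ᵐ[volume] deriv ψ) ∧
      ∀ x, -lam ^ 2 * (ρ x * k ^ 2 * ψ x - deriv (fun y => ρ y * deriv ψ y) x) =
        lam * μ * (k ^ 4 * ψ x - 2 * k ^ 2 * iteratedDeriv 2 ψ x + iteratedDeriv 4 ψ x)
          - g * k ^ 2 * deriv ρ x * ψ x
          + (a 0 * ψ x - a 1 * iteratedDeriv 2 ψ x + a 2 * iteratedDeriv 4 ψ x) := by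
  set c := growthCoeff ρ μ g k a lam with hc
  have hcontDiff (i : Fin 3) : ContDiff ℝ ∞ (c i) := contDiff_growthCoeff hρ μ g k a lam i
  have hbdd (i : Fin 3) (n : ℕ) : MemLp (iteratedDeriv n (c i)) ⊤ :=
    memLp_top_iteratedDeriv (memLp_growthCoeff hρ μ g k a lam i)
      (isTestFunction_deriv_growthCoeff hρ μ g k a lam i) n
  obtain ⟨ψ, hψ, ⟨h0, h1, h2⟩, hode⟩ := exists_contDiff_solution_of_weak_solution hb
    (hcontDiff 1) (hcontDiff 0) (hasWeakDeriv u 0) (hasWeakDeriv u 1)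
    fun φ hφ => integral_growthCoeff_of_growthForm_eq_zero hu hφ
  have hL2 : ∀ j ≤ 2, MemLp (iteratedDeriv j ψ) 2 := by
    intro j hj
    interval_cases j
    · exact iteratedDeriv_zero (f := ψ) ▸ (Lp.memLp _).ae_eq h0
    · exact iteratedDeriv_one (f := ψ) ▸ (Lp.memLp _).ae_eq h1
    · exact (Lp.memLp _).ae_eq h2
  refine ⟨ψ, hψ, memLp_two_iteratedDeriv_of_solution hb (hcontDiff 1) (hcontDiff 0) (hbdd 1)
    (hbdd 0) hψ hode hL2, ⟨h0, h1⟩, fun x => ?_⟩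
  have hψ' : ContDiff ℝ ∞ (deriv ψ) := (contDiff_infty_iff_deriv.1 hψ).2
  have hflux : deriv (fun y => c 1 y * deriv ψ y) x =
      lam ^ 2 * deriv (fun y => ρ y * deriv ψ y) x +
        (2 * lam * μ * k ^ 2 + a 1) * iteratedDeriv 2 ψ x := by
    have hd := (contDiff_infty_iff_deriv.1 (hρ.smooth.mul hψ')).1 x
    have hd' := (contDiff_infty_iff_deriv.1 hψ').1 x
    rw [iteratedDeriv_succ, iteratedDeriv_one, ← deriv_const_mul _ hd, ← deriv_const_mul _ hd',
      ← deriv_add (hd.const_mul _) (hd'.const_mul _)]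
    congr 1
    ext y
    simp only [hc, growthCoeff, Matrix.cons_val_one, Matrix.cons_val_zero, Pi.add_apply]
    ring
  have h := hode x
  rw [hflux, hc] at h
  simp only [growthCoeff, Matrix.cons_val_zero] at h
  linarith

/-! ### Negative directions of the growth form -/

theorem MemH.memLp {n : ℕ} {f : ℝ → ℝ} (hf : MemH n f) : MemLp f 2 := by
  cases n with
  | zero => exact hf
  | succ n => exact hf.1

theorem MemH.congr {n : ℕ} {f g : ℝ → ℝ} (hf : MemH n f) (h : f =ᵐ[volume] g) : MemH n g := by
  cases n with
  | zero => exact MemLp.ae_eq h hf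
  | succ n =>
    obtain ⟨hf, f', hw, hf'⟩ := hf
    exact ⟨hf.ae_eq h, f', hw.congr h .rfl, hf'⟩

theorem MemH.of_hasWeakDeriv {n : ℕ} {f f' : ℝ → ℝ} (hf : MemH (n + 1) f)
    (hw : HasWeakDeriv f f') : MemH n f' := by
  obtain ⟨-, f'', hw', hf''⟩ := hf
  exact hf''.congr (hw'.unique hw)

theorem energyForm_mk {m : ℕ} {c : Fin (m + 1) → ℝ → ℝ} (hc : ∀ i, MemLp (c i) ∞)
    {u : Fin (m + 1) → ℝ → ℝ} (hu : ∀ i, MemLp (u i) 2)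
    (hw : ∀ i : Fin m, HasWeakDeriv (u i.castSucc) (u i.succ)) :
    energyForm c hc (mk u hu hw) (mk u hu hw) = ∑ i, ∫ x, c i x * u i x ^ 2 := by
  rw [energyForm_apply]
  exact Finset.sum_congr rfl fun i _ => integral_congr_ae ((derivL_mk hu hw i).mono fun x hx => by
    simp only [hx, sq, mul_assoc])

theorem integral_sub_mul_sq {w f : ℝ → ℝ} (hw : MemLp w ∞) (hf : MemLp f 2) (a : ℝ) :
    ∫ x, (a - w x) * f x ^ 2 = a * (∫ x, f x ^ 2) - ∫ x, w x * f x ^ 2 := by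
  have hwf : Integrable fun x => w x * f x ^ 2 := hf.integrable_sq.mul_of_top_right hw
  simp only [sub_mul]
  rw [integral_sub (hf.integrable_sq.const_mul a) hwf, integral_const_mul]

theorem exists_isTestFunction_lt {w ψ ψ' : ℝ → ℝ} {a b : ℝ} (hw : MemLp w ∞) (hψ : MemLp ψ 2)
    (hψ' : MemLp ψ' 2) (hψψ' : HasWeakDeriv ψ ψ')
    (h : a * (∫ x, ψ x ^ 2) + b * (∫ x, ψ' x ^ 2) < ∫ x, w x * ψ x ^ 2) :
    ∃ φ, IsTestFunction φ ∧
      a * (∫ x, φ x ^ 2) + b * (∫ x, deriv φ x ^ 2) < ∫ x, w x * φ x ^ 2 := by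
  set c : Fin 2 → ℝ → ℝ := ![fun x => a - w x, fun _ => b]
  have hc : ∀ i, MemLp (c i) ∞ :=
    Fin.forall_fin_two.2 ⟨(memLp_top_const a).sub hw, memLp_top_const b⟩
  have henergy {u : Fin 2 → ℝ → ℝ} (hu : ∀ i, MemLp (u i) 2)
      (huw : ∀ i : Fin 1, HasWeakDeriv (u i.castSucc) (u i.succ)) :
      energyForm c hc (mk u hu huw) (mk u hu huw) =
        a * (∫ x, u 0 x ^ 2) + b * (∫ x, u 1 x ^ 2) - ∫ x, w x * u 0 x ^ 2 := by
    rw [energyForm_mk, Fin.sum_univ_two, show c 0 = fun x => a - w x from rfl,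
      show c 1 = fun _ => b from rfl, integral_sub_mul_sq hw (hu 0), integral_const_mul]
    ring
  have hL2 : ∀ i, MemLp (![ψ, ψ'] i) 2 := Fin.forall_fin_two.2 ⟨hψ, hψ'⟩
  have hopen : IsOpen {u | energyForm c hc u u < 0} :=
    isOpen_lt (by fun_prop) continuous_const
  obtain ⟨u, hu, hneg⟩ := dense_testSpace_one.exists_mem_open hopen
    ⟨mk ![ψ, ψ'] hL2 (Fin.forall_fin_one.2 hψψ'), by
      rw [Set.mem_ofPred_eq, henergy]; exact sub_neg.2 h⟩
  obtain ⟨φ, hφ, rfl⟩ := exists_eq_toSobolev_of_mem_testSpace hu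
  refine ⟨φ, hφ, sub_neg.1 ?_⟩
  rw [Set.mem_ofPred_eq, IsTestFunction.toSobolev, henergy] at hneg
  simpa only [Fin.val_zero, Fin.val_one, iteratedDeriv_zero, iteratedDeriv_one] using hneg

theorem exists_isTestFunction_integral_mul_sq_pos {w : ℝ → ℝ} (hw : Continuous w) {x₀ : ℝ}
    (hx₀ : 0 < w x₀) : ∃ φ, IsTestFunction φ ∧ 0 < ∫ x, w x * φ x ^ 2 := by
  obtain ⟨r, hr, hball⟩ := Metric.isOpen_iff.1 (isOpen_lt continuous_const hw) x₀ hx₀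
  let φ : ContDiffBump x₀ := ⟨r / 2, r, by positivity, by linarith⟩
  have hφ : IsTestFunction φ := ⟨φ.contDiff, φ.hasCompactSupport⟩
  refine ⟨φ, hφ, (hw.mul (hφ.continuous.pow 2)).integral_pos_of_hasCompactSupport_nonneg_nonzero
    (HasCompactSupport.mul_left ?_) (fun x => ?_) (x := x₀) ?_⟩
  · exact hφ.hasCompactSupport.comp_left (g := fun y : ℝ => y ^ 2) (by simp)
  · by_cases hx : x ∈ Metric.ball x₀ r
    · exact mul_nonneg (le_of_lt (hball hx)) (sq_nonneg _)
    · have : φ x = 0 := φ.zero_of_le_dist (not_lt.1 hx)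
      simp [this]
  · have : φ x₀ = 1 := φ.one_of_mem_closedBall (Metric.mem_closedBall_self φ.rIn_pos.le)
    simp [this, hx₀.ne']

theorem exists_isTestFunction_of_lt_criticalFrequency {g M : ℝ} {ρ : ℝ → ℝ} (hρ : IsRTProfile ρ)
    {ξ : EuclideanSpace ℝ (Fin 2)} (hξ : M * ξ 0 ≠ 0) (h : ‖ξ‖ < criticalFrequency g M ρ ξ) :
    ∃ φ, IsTestFunction φ ∧
      (M * ξ 0) ^ 2 * ‖ξ‖ ^ 2 * (∫ x, φ x ^ 2) + (M * ξ 0) ^ 2 * (∫ x, deriv φ x ^ 2) <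
        ∫ x, g * ‖ξ‖ ^ 2 * deriv ρ x * φ x ^ 2 := by
  rw [criticalFrequency, Real.lt_sqrt (norm_nonneg ξ)] at h
  obtain ⟨r, ⟨ψ, ψ', hψ, hw, -, rfl⟩, hr⟩ := exists_lt_of_lt_csSup (by
    by_contra hne
    rw [Set.not_nonempty_iff_eq_empty.1 hne, Real.sSup_empty] at h
    exact h.not_ge (sq_nonneg _)) h
  have hm : 0 < (M * ξ 0) ^ 2 := by positivity
  have hψ_pos : 0 < ∫ x, ψ x ^ 2 := by
    refine (integral_nonneg fun x => sq_nonneg (ψ x)).lt_of_ne fun h0 => hr.not_ge ?_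
    rw [← h0, div_zero]
    exact sq_nonneg _
  rw [lt_div_iff₀ hψ_pos, lt_sub_iff_add_lt, lt_div_iff₀ hm] at hr
  refine exists_isTestFunction_lt ((hρ.isTestFunction_deriv.memLp ⊤).const_mul _) hψ.memLp
    (hψ.of_hasWeakDeriv hw).memLp hw ?_
  simp only [mul_assoc (g * ‖ξ‖ ^ 2), integral_const_mul]
  linarith

theorem lt_sSup_criticalQuotients {g M : ℝ} {ρ : ℝ → ℝ}
    (h : ENNReal.ofReal |M| < criticalNumber g ρ) :
    ((M ^ 2 : ℝ) : EReal) < sSup (criticalQuotients g ρ) := by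
  contrapose! h
  refine (ENNReal.rpow_le_rpow (EReal.toENNReal_le_toENNReal h) (by norm_num)).trans_eq ?_
  rw [EReal.toENNReal_of_ne_top (EReal.coe_ne_top _), EReal.toReal_coe,
    ENNReal.ofReal_rpow_of_nonneg (sq_nonneg M) (by norm_num), ← Real.sqrt_eq_rpow,
    Real.sqrt_sq_eq_abs]

theorem exists_isTestFunction_of_lt_criticalNumber {g M : ℝ} {ρ : ℝ → ℝ} (hρ : IsRTProfile ρ)
    (h : ENNReal.ofReal |M| < criticalNumber g ρ) :
    ∃ φ, IsTestFunction φ ∧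
      M ^ 2 * (∫ x, deriv φ x ^ 2) < ∫ x, g * deriv ρ x * φ x ^ 2 := by
  obtain ⟨_, ⟨ψ, ψ', hψ, hw, -, rfl⟩, hr⟩ := lt_sSup_iff.1 (lt_sSup_criticalQuotients h)
  rw [EReal.coe_lt_coe_iff] at hr
  have hψ'_pos : 0 < ∫ x, ψ' x ^ 2 := by
    refine (integral_nonneg fun x => sq_nonneg (ψ' x)).lt_of_ne fun h0 => hr.not_ge ?_
    rw [← h0, div_zero]
    exact sq_nonneg M
  rw [lt_div_iff₀ hψ'_pos] at hr
  simpa only [zero_mul, zero_add] using exists_isTestFunction_lt (a := 0)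
    ((hρ.isTestFunction_deriv.memLp ⊤).const_mul g) hψ.memLp (hψ.of_hasWeakDeriv hw).memLp hw
    (by simpa only [zero_mul, zero_add] using hr)

theorem exists_of_verticalCriticalFrequency_lt {g M k : ℝ} {ρ : ℝ → ℝ} (hρ : IsRTProfile ρ)
    (hMc : ENNReal.ofReal |M| < criticalNumber g ρ) (hk : 0 < k)
    (h : verticalCriticalFrequency g M ρ < k) :
    ∃ ψ ψ' ψ'' : ℝ → ℝ, MemH 2 ψ ∧ HasWeakDeriv ψ ψ' ∧ HasWeakDeriv ψ' ψ'' ∧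
      M ^ 2 * k ^ 2 * (∫ x, ψ' x ^ 2) + M ^ 2 * (∫ x, ψ'' x ^ 2) <
        ∫ x, g * k ^ 2 * deriv ρ x * ψ x ^ 2 := by
  have hsplit {f f' : ℝ → ℝ} (hf : MemLp f 2) (hf' : MemLp f' 2) :
      ∫ x, (g * deriv ρ x * f x ^ 2 - M ^ 2 * f' x ^ 2) =
        (∫ x, g * deriv ρ x * f x ^ 2) - M ^ 2 * ∫ x, f' x ^ 2 := by
    have hi : Integrable fun x => g * deriv ρ x * f x ^ 2 :=
      hf.integrable_sq.mul_of_top_right ((hρ.isTestFunction_deriv.memLp ⊤).const_mul g)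
    rw [integral_sub hi (hf'.integrable_sq.const_mul _), integral_const_mul]
  rw [verticalCriticalFrequency, Real.sqrt_lt' hk] at h
  obtain ⟨r, ⟨ψ, ψ', ψ'', hψ, hw, hw', hpos, rfl⟩, hr⟩ := exists_lt_of_csInf_lt (by
    obtain ⟨φ, hφ, hlt⟩ := exists_isTestFunction_of_lt_criticalNumber hρ hMc
    refine ⟨_, φ, deriv φ, deriv (deriv φ), hφ.memH 2, hφ.hasWeakDeriv_deriv,
      hφ.deriv.hasWeakDeriv_deriv, ?_, rfl⟩
    rw [hsplit (hφ.memLp 2) (hφ.deriv.memLp 2)]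
    exact sub_pos.2 hlt) h
  refine ⟨ψ, ψ', ψ'', hψ, hw, hw', ?_⟩
  rw [div_lt_iff₀ hpos, hsplit hψ.memLp (hψ.of_hasWeakDeriv hw).memLp] at hr
  simp only [mul_assoc g, integral_const_mul] at hr
  simp only [mul_assoc (g * k ^ 2), integral_const_mul]
  linarith

/-- The coefficients `a₀, a₁, a₂` for which `M²` times the magnetic term at `ψ` is
`a₀ ψ - a₁ ψ'' + a₂ ψ''''`. -/
noncomputable def magneticCoeff (M : ℝ) (ξ : EuclideanSpace ℝ (Fin 2)) :
    FieldDirection → Fin 3 → ℝ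
  | .horizontal => ![(M * ξ 0) ^ 2 * ‖ξ‖ ^ 2, (M * ξ 0) ^ 2, 0]
  | .vertical => ![0, M ^ 2 * ‖ξ‖ ^ 2, M ^ 2]

theorem magneticCoeff_nonneg (M : ℝ) (ξ : EuclideanSpace ℝ (Fin 2)) (d : FieldDirection)
    (i : Fin 3) : 0 ≤ magneticCoeff M ξ d i := by
  cases d <;> fin_cases i <;> simp only [magneticCoeff, Fin.zero_eta, Fin.mk_one,
    Fin.reduceFinMk, Matrix.cons_val_zero, Matrix.cons_val_one, Matrix.cons_val] <;> positivity

theorem sq_mul_magneticTerm (M : ℝ) (ξ : EuclideanSpace ℝ (Fin 2)) (ψ : ℝ → ℝ) (x : ℝ)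
    (d : FieldDirection) :
    M ^ 2 * magneticTerm ξ ψ x d = magneticCoeff M ξ d 0 * ψ x -
      magneticCoeff M ξ d 1 * iteratedDeriv 2 ψ x +
        magneticCoeff M ξ d 2 * iteratedDeriv 4 ψ x := by
  cases d <;> simp only [magneticTerm, magneticCoeff, Matrix.cons_val_zero, Matrix.cons_val_one,
    Matrix.cons_val] <;> ring

theorem exists_growthForm_zero_neg {ρ : ℝ → ℝ} (hρ : IsRTProfile ρ) (μ : ℝ) {g k : ℝ}
    {a : Fin 3 → ℝ} {ψ ψ' ψ'' : ℝ → ℝ} (hψ : MemH 2 ψ) (hw : HasWeakDeriv ψ ψ')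
    (hw' : HasWeakDeriv ψ' ψ'')
    (h : a 0 * (∫ x, ψ x ^ 2) + a 1 * (∫ x, ψ' x ^ 2) + a 2 * (∫ x, ψ'' x ^ 2) <
      ∫ x, g * k ^ 2 * deriv ρ x * ψ x ^ 2) :
    ∃ u, growthForm hρ μ g k a 0 u u < 0 := by
  have hψ' := hψ.of_hasWeakDeriv hw
  have hL2 : ∀ i, MemLp (![ψ, ψ', ψ''] i) 2 :=
    Fin.forall_fin_succ.2 ⟨hψ.memLp, Fin.forall_fin_two.2
      ⟨hψ'.memLp, (hψ'.of_hasWeakDeriv hw').memLp⟩⟩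
  refine ⟨mk ![ψ, ψ', ψ''] hL2 (Fin.forall_fin_two.2 ⟨hw, hw'⟩), ?_⟩
  have hc : growthCoeff ρ μ g k a 0 =
      ![fun x => a 0 - g * k ^ 2 * deriv ρ x, fun _ => a 1, fun _ => a 2] := by
    simp [growthCoeff]
  rw [growthForm, energyForm_mk, Fin.sum_univ_three, hc]
  simp only [Matrix.cons_val_zero, Matrix.cons_val_one, Matrix.cons_val, integral_const_mul]
  rw [integral_sub_mul_sq ((hρ.isTestFunction_deriv.memLp ⊤).const_mul _) hψ.memLp]
  linarith

theorem norm_pos_of_mem_solvableDomain {g M : ℝ} {ρ : ℝ → ℝ} {d : FieldDirection}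
    {ξ : EuclideanSpace ℝ (Fin 2)} (hξ : ξ ∈ solvableDomain g M ρ d) : 0 < ‖ξ‖ := by
  cases d with
  | horizontal => exact norm_pos_iff.2 hξ.2
  | vertical => exact (Real.sqrt_nonneg _).trans_lt hξ

theorem exists_growthForm_neg_of_mem_solvableDomain {ρ : ℝ → ℝ} (hρ : IsRTProfile ρ) (μ : ℝ)
    {g M : ℝ} (hg : 0 < g) {d : FieldDirection} (hM : M ≠ 0)
    (hMc : d = FieldDirection.vertical → ENNReal.ofReal |M| < criticalNumber g ρ)
    {ξ : EuclideanSpace ℝ (Fin 2)} (hξ : ξ ∈ solvableDomain g M ρ d) :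
    ∃ u, growthForm hρ μ g ‖ξ‖ (magneticCoeff M ξ d) 0 u u < 0 := by
  cases d with
  | horizontal =>
    obtain ⟨hξ, hξ0⟩ := hξ
    suffices hφ : ∃ φ, IsTestFunction φ ∧ (M * ξ 0) ^ 2 * ‖ξ‖ ^ 2 * (∫ x, φ x ^ 2) +
        (M * ξ 0) ^ 2 * (∫ x, deriv φ x ^ 2) < ∫ x, g * ‖ξ‖ ^ 2 * deriv ρ x * φ x ^ 2 by
      obtain ⟨φ, hφ, hlt⟩ := hφ
      refine exists_growthForm_zero_neg hρ μ (hφ.memH 2) hφ.hasWeakDeriv_deriv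
        hφ.deriv.hasWeakDeriv_deriv ?_
      simpa [magneticCoeff] using hlt
    by_cases h0 : ξ 0 = 0
    · obtain ⟨x₀, hx₀⟩ := hρ.exists_deriv_pos
      obtain ⟨φ, hφ, hpos⟩ := exists_isTestFunction_integral_mul_sq_pos
        (w := fun x => g * ‖ξ‖ ^ 2 * deriv ρ x)
        (hρ.isTestFunction_deriv.continuous.const_mul _) (x₀ := x₀)
        (mul_pos (mul_pos hg (pow_pos (norm_pos_iff.2 hξ0) 2)) hx₀)
      exact ⟨φ, hφ, by simpa [h0] using hpos⟩
    · obtain ⟨-, -, hlt⟩ := hξ.resolve_right h0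
      exact exists_isTestFunction_of_lt_criticalFrequency hρ (mul_ne_zero hM h0) hlt
  | vertical =>
    obtain ⟨ψ, ψ', ψ'', hψ, hw, hw', hneg⟩ := exists_of_verticalCriticalFrequency_lt hρ (hMc rfl)
      (norm_pos_of_mem_solvableDomain hξ) hξ
    refine exists_growthForm_zero_neg hρ μ hψ hw hw' ?_
    simpa [magneticCoeff] using hneg

theorem theorem2p1 (μ g M : ℝ) (hμ : 0 < μ) (hg : 0 < g) (ρ : ℝ → ℝ) (hρ : IsRTProfile ρ)
    (d : FieldDirection) (hM : M ≠ 0)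
    (hMc : d = FieldDirection.vertical → ENNReal.ofReal |M| < criticalNumber g ρ)
    (ξ : EuclideanSpace ℝ (Fin 2)) (hξ : ξ ∈ solvableDomain g M ρ d) :
    ∃ (ψ : ℝ → ℝ) (lam : ℝ), 0 < lam ∧ ψ ≠ 0 ∧ ContDiff ℝ ∞ ψ ∧
      SatisfiesODE d μ g M ρ ξ lam ψ ∧ VanishesAtInfinity ψ ∧
      MemHInfty ψ ∧ ψ ∈ admissibleSet ρ ξ := by
  have hk : 0 < ‖ξ‖ := norm_pos_of_mem_solvableDomain hξ
  have ha := magneticCoeff_nonneg M ξ d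
  obtain ⟨lam, hlam, u, hu0, hu⟩ := exists_growthForm_eq_zero hρ hμ hk ha
    (exists_growthForm_neg_of_mem_solvableDomain hρ μ hg hM hMc hξ)
  obtain ⟨s, hs⟩ := exists_smul_integral_inertia_eq_one hρ hk.ne' hu0
  obtain ⟨ψ, hψ, hL2, ⟨h0, h1⟩, hode⟩ := exists_contDiff_of_growthForm_eq_zero
    (add_pos_of_pos_of_nonneg (mul_pos hlam hμ) (ha 2)).ne' (u := s • u) fun v => by
      rw [map_smul, smul_apply, hu v, smul_zero]
  have hnorm : ∫ x, ρ x * (‖ξ‖ ^ 2 * ψ x ^ 2 + deriv ψ x ^ 2) = 1 := hs ▸ integral_congr_ae (by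
    filter_upwards [h0, h1] with x hx0 hx1
    rw [hx0, hx1])
  have hH := memHInfty_of_forall_memLp_iteratedDeriv hψ hL2
  obtain ⟨hd, hψ'⟩ := contDiff_infty_iff_deriv.1 hψ
  refine ⟨ψ, lam, hlam, ?_, hψ, fun x => ?_,
    vanishesAtInfinity_of_forall_memLp_iteratedDeriv hψ hL2, hH, hH 2, deriv ψ,
    .of_hasDerivAt (fun x => (hd x).hasDerivAt) hψ'.continuous, hnorm⟩
  · rintro rfl
    simp at hnorm
  · rw [hode x, sq_mul_magneticTerm]
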